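/- **Setting.** Let $\mathcal X,\mathcal Y,\mathcal Z$ be finite alphabets ($\mathcal Z$ nonempty), let $\mathcal W_x,\mathcal W_y$ be discrete alphabets, let $P_X$ be a source distribution on $\mathcal X$, let $P_{W_x|X}$, $P_{W_y|Y}$ be channels, and let $\pi:\mathcal X\times\mathcal Y\times\mathcal Z\to[-\infty,\infty)$ be a payoff function. Write $[a]=\{1,\dots,\lfloor a\rfloor\}$ and $0\cdot(-\infty)=0$. For real $R,R_0$, an $(n,R,R_0)$ code consists of a stochastic encoder $P_{M|X^nK}$ and a stochastic decoder $P_{Y^n|MK}$ with $M\in[2^{nR}]$ and $K\in[2^{nR_0}]$; here $X^n$ is i.i.d. with law $P_X$ and the key $K$ is uniform on $[2^{nR_0}]$ (which must be nonempty) and independent of $X^n$. Let $W_x^n$ and $W_y^n$ be the outputs of the memoryless channels $\prod P_{W_x|X}$ and $\prod P_{W_y|Y}$ with inputs $X^n$ and $Y^n$, and put $W_i=(W_{x,i},W_{y,i})$. In step $i$ an adversary, who sees the message $M$ and the current disclosure symbol $W_i$ (and not $W^{i-1}$), produces $Z_i$ by a strategy $P_{Z_i|M,W_i}$. A real triple $(R,R_0,\Pi)$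 is achievable if there is a sequence of $(n,R,R_0)$ codes such that - (AVG) $\displaystyle\liminf_{n\to\infty}\min_{\{P_{Z_i|M,W_i}\}_{i=1}^n}\mathbb E\,\frac1n\sum_{i=1}^n\pi(X_i,Y_i,Z_i)\ge\Pi$; - (WHP) $\displaystyle\lim_{n\to\infty}\min_{\{P_{Z_i|M,W_i}\}_{i=1}^n}\mathbb P\Big[\frac1n\sum_{i=1}^n\pi(X_i,Y_i,Z_i)\ge\Pi\Big]=1$; - (MIN) $\displaystyle\liminf_{n\to\infty}\min_{i\in[n]}\min_{P_{Z|M,W_i}}\mathbb E\,\pi(X_i,Y_i,Z)\ge\Pi$, under the respective criterion. The rate-payoff region $\mathcal R_{\mathrm{AVG}}$, $\mathcal R_{\mathrm{WHP}}$, $\mathcal R_{\mathrm{MIN}}$ is the closure in $\mathbb R^3$ of the set of triples achievable under that criterion. **Theorem.** Let $$\mathcal S=\bigcup_{P_{Y|X}}\Big\{(R,R_0,\Pi)\in\mathbb R^3:\ R\ge I(X;Y),\ R_0\ge 0,\ \Pi\le\min_{z:\mathcal W_x\times\mathcal W_y\to\mathcal Z}\mathbb E\,\pi\big(X,Y,z(W_x,W_y)\big)\Big\},$$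 where the union is over all channels from $\mathcal X$ to $\mathcal Y$, $I$ is mutual information in bits, and $(X,Y,W_x,W_y)$ has law $P_XP_{Y|X}P_{W_x|X}P_{W_y|Y}$. Then $\mathcal R_{\mathrm{WHP}}=\mathcal S$. If moreover $\pi$ is real-valued, then also $\mathcal R_{\mathrm{AVG}}=\mathcal R_{\mathrm{MIN}}=\mathcal S$; so all three regions equal $\mathcal S$. -/

import Mathlib

open Filter Topology
open scoped ENNReal

noncomputable section

namespace SecrecyCoding

theorem tsum_prod_pmf {α : Type*} : ∀ (n : ℕ) (p : Fin n → PMF α),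
    ∑' f : Fin n → α, ∏ i, p i (f i) = 1 := by
  intro n
  induction n with
  | zero =>
    intro p
    rw [tsum_eq_single (fun i => i.elim0) (fun b hb => absurd (Subsingleton.elim _ _) hb)]
    simp
  | succ n ih =>
    intro p
    rw [← (Fin.consEquiv (fun _ : Fin (n + 1) => α)).tsum_eq, ENNReal.tsum_prod']
    simp only [Fin.consEquiv_apply, Fin.prod_univ_succ, Fin.cons_zero, Fin.cons_succ,
      ENNReal.tsum_mul_left, ih (fun i => p i.succ), mul_one, (p 0).tsum_coe]

/-- The product distribution `∏ᵢ pᵢ` on sequences of length `n`. -/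
def productPMF {α : Type*} {n : ℕ} (p : Fin n → PMF α) : PMF (Fin n → α) :=
  ⟨fun f => ∏ i, p i (f i), by
    have h := ENNReal.summable (f := fun f : Fin n → α => ∏ i, p i (f i)) |>.hasSum
    rwa [tsum_prod_pmf n p] at h⟩

/-- The expectation of a `[-∞, ∞)`-valued function of a random variable with a finite alphabet
(with the convention `0 * (-∞) = 0`). -/
def expect {Ω : Type*} [Fintype Ω] (p : PMF Ω) (f : Ω → EReal) : EReal :=
  ∑ ω, ((p ω : ℝ≥0∞) : EReal) * f ω

/-- The mutual information, in bits, of a pair of random variables with finite alphabets and joint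
distribution `p` (with the convention `0 * log 0 = 0`). -/
def mutualInfo {X Y : Type*} [Fintype X] [Fintype Y] (p : PMF (X × Y)) : ℝ :=
  ∑ x, ∑ y, (p (x, y)).toReal *
    Real.logb 2 ((p (x, y)).toReal / ((p.map Prod.fst x).toReal * (p.map Prod.snd y).toReal))

/-- The size of the index set `[2^{nR}] = {1, …, ⌊2^{nR}⌋}`. -/
def indexSize (n : ℕ) (R : ℝ) : ℕ := ⌊(2 : ℝ) ^ ((n : ℝ) * R)⌋₊

/-- An `(n, R, R₀)` code: a stochastic encoder `P_{M | Xⁿ, K}` and a stochastic decoder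
`P_{Yⁿ | M, K}`, with messages in `[2^{nR}]` and keys in the nonempty set `[2^{nR₀}]`. -/
structure Code (X Y : Type*) (n : ℕ) (R R₀ : ℝ) where
  key_pos : 0 < indexSize n R₀
  encoder : (Fin n → X) → Fin (indexSize n R₀) → PMF (Fin (indexSize n R))
  decoder : Fin (indexSize n R) → Fin (indexSize n R₀) → PMF (Fin n → Y)

section System

variable {X Y Z Wx Wy : Type*} {n : ℕ} {R R₀ : ℝ}

/-- The key is uniformly distributed. -/
def Code.keyLaw (c : Code X Y n R R₀) : PMF (Fin (indexSize n R₀)) :=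
  haveI : Nonempty (Fin (indexSize n R₀)) := ⟨⟨0, c.key_pos⟩⟩
  PMF.uniformOfFintype (Fin (indexSize n R₀))

/-- The joint law of `(Xⁿ, Yⁿ, M, W_xⁿ, W_yⁿ)`: `Xⁿ` is i.i.d. with law `PX`, the key is uniform and
independent of `Xⁿ`, and `W_xⁿ`, `W_yⁿ` are the outputs of memoryless channels with inputs `Xⁿ`
and `Yⁿ`. -/
def systemLaw (PX : PMF X) (PWx : X → PMF Wx) (PWy : Y → PMF Wy) (c : Code X Y n R R₀) :
    PMF ((Fin n → X) × (Fin n → Y) × Fin (indexSize n R) × (Fin n → Wx) × (Fin n → Wy)) :=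
  (productPMF fun _ : Fin n => PX).bind fun x =>
  c.keyLaw.bind fun k =>
  (c.encoder x k).bind fun m =>
  (c.decoder m k).bind fun y =>
  (productPMF fun i => PWx (x i)).bind fun wx =>
  (productPMF fun i => PWy (y i)).bind fun wy =>
  PMF.pure (x, y, m, wx, wy)

/-- The law of `(Xⁿ, Yⁿ, Zⁿ)` when, in step `i`, the adversary draws `Z_i` from
`P_{Z_i | M, W_i}`, where `W_i = (W_{x,i}, W_{y,i})`; here `s i` is `P_{Z_i | M, W_i}`. -/
def blockLaw (PX : PMF X) (PWx : X → PMF Wx) (PWy : Y → PMF Wy) (c : Code X Y n R R₀)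
    (s : Fin n → Fin (indexSize n R) → Wx × Wy → PMF Z) :
    PMF ((Fin n → X) × (Fin n → Y) × (Fin n → Z)) :=
  (systemLaw PX PWx PWy c).bind fun ⟨x, y, m, wx, wy⟩ =>
    (productPMF fun i => s i m (wx i, wy i)).map fun z => (x, y, z)

/-- The law of `(X_i, Y_i, Z)` when the adversary draws `Z` from `s = P_{Z | M, W_i}`. -/
def symbolLaw (PX : PMF X) (PWx : X → PMF Wx) (PWy : Y → PMF Wy) (c : Code X Y n R R₀)
    (i : Fin n) (s : Fin (indexSize n R) → Wx × Wy → PMF Z) : PMF (X × Y × Z) :=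
  (systemLaw PX PWx PWy c).bind fun ⟨x, y, m, wx, wy⟩ =>
    (s m (wx i, wy i)).map fun z => (x i, y i, z)

/-- The block-average payoff `(1/n) ∑ᵢ π(x_i, y_i, z_i)`. -/
def blockPayoff (π : X → Y → Z → EReal) (ω : (Fin n → X) × (Fin n → Y) × (Fin n → Z)) : EReal :=
  (((n : ℝ)⁻¹ : ℝ) : EReal) * ∑ i, π (ω.1 i) (ω.2.1 i) (ω.2.2 i)

end System

section Regions

variable {X Y Z Wx Wy : Type*} [Fintype X] [Fintype Y] [Fintype Z]

/-- Achievability of `(R, R₀, Π)` under the expected payoff criterion, with `W_i` disclosed. -/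
def AchievableAvg (PX : PMF X) (PWx : X → PMF Wx) (PWy : Y → PMF Wy) (π : X → Y → Z → EReal)
    (R R₀ P : ℝ) : Prop :=
  ∃ c : (n : ℕ) → Code X Y n R R₀,
    (P : EReal) ≤ liminf (fun n : ℕ =>
      ⨅ s : Fin n → Fin (indexSize n R) → Wx × Wy → PMF Z,
        expect (blockLaw PX PWx PWy (c n) s) (blockPayoff π)) atTop

/-- Achievability of `(R, R₀, Π)` under the assured payoff criterion, with `W_i` disclosed. -/
def AchievableWhp (PX : PMF X) (PWx : X → PMF Wx) (PWy : Y → PMF Wy) (π : X → Y → Z → EReal)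
    (R R₀ P : ℝ) : Prop :=
  ∃ c : (n : ℕ) → Code X Y n R R₀,
    Tendsto (fun n : ℕ =>
      ⨅ s : Fin n → Fin (indexSize n R) → Wx × Wy → PMF Z,
        (blockLaw PX PWx PWy (c n) s).toOuterMeasure {ω | (P : EReal) ≤ blockPayoff π ω})
      atTop (𝓝 (1 : ℝ≥0∞))

/-- Achievability of `(R, R₀, Π)` under the symbol-wise minimum payoff criterion, with `W_i`
disclosed. -/
def AchievableMin (PX : PMF X) (PWx : X → PMF Wx) (PWy : Y → PMF Wy) (π : X → Y → Z → EReal)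
    (R R₀ P : ℝ) : Prop :=
  ∃ c : (n : ℕ) → Code X Y n R R₀,
    (P : EReal) ≤ liminf (fun n : ℕ =>
      ⨅ i : Fin n, ⨅ s : Fin (indexSize n R) → Wx × Wy → PMF Z,
        expect (symbolLaw PX PWx PWy (c n) i s) (fun ω => π ω.1 ω.2.1 ω.2.2)) atTop

/-- The rate-payoff region of an achievability notion: the closure of the achievable triples. -/
def ratePayoffRegion (achievable : ℝ → ℝ → ℝ → Prop) : Set (ℝ × ℝ × ℝ) :=
  closure {t | achievable t.1 t.2.1 t.2.2}

/-- The joint law of `(X, Y)` with `X ∼ PX` and `Y` the output of the channel `PY = P_{Y|X}`. -/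
def jointLaw (PX : PMF X) (PY : X → PMF Y) : PMF (X × Y) :=
  PX.bind fun x => (PY x).map fun y => (x, y)

/-- The law of `(X, Y, z(W_x, W_y))`, where `W_x - X - Y - W_y` is a Markov chain. -/
def singleLetterLaw (PX : PMF X) (PWx : X → PMF Wx) (PWy : Y → PMF Wy) (PY : X → PMF Y)
    (z : Wx × Wy → Z) : PMF (X × Y × Z) :=
  (jointLaw PX PY).bind fun ⟨x, y⟩ =>
  (PWx x).bind fun wx =>
  (PWy y).bind fun wy =>
  PMF.pure (x, y, z (wx, wy))

/-- The single-letter region: the union over all channels `P_{Y|X}` of the sets of triples with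
`R ≥ I(X;Y)`, `R₀ ≥ 0` and `Π ≤ min_z E π(X, Y, z(W_x, W_y))`. -/
def singleLetterRegion (PX : PMF X) (PWx : X → PMF Wx) (PWy : Y → PMF Wy)
    (π : X → Y → Z → EReal) : Set (ℝ × ℝ × ℝ) :=
  ⋃ PY : X → PMF Y,
    {t | mutualInfo (jointLaw PX PY) ≤ t.1 ∧ 0 ≤ t.2.1 ∧
      (t.2.2 : EReal) ≤ ⨅ z : Wx × Wy → Z,
        expect (singleLetterLaw PX PWx PWy PY z) (fun ω => π ω.1 ω.2.1 ω.2.2)}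

end Regions

end SecrecyCoding

end

noncomputable section

namespace SecrecyCoding

/-! ### Moments of independent samples with real weights -/

section ProductMoments

variable {ι α : Type*} [Fintype ι] [DecidableEq ι] [Fintype α]

/-! Converse. Let `p` be the time-averaged joint law of `(X_i, Y_i)` under a code (`averageLaw`).
Its first marginal is `PX`. An adversary who ignores the message and always plays the same map `z`
earns an average payoff that is linear in `p`, so payoff guarantees of the code become single-letter
guarantees for `p`. The rate bound `info p ≤ R` uses a change of measure in place of entropy chain
rules: since encoder probabilities are at most one, a message with `M` values raises the expectation
of a nonnegative `f(Xⁿ, Yⁿ)` at most `M` times above its value for an independent source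
(`mean_codeLaw_le`). Taking `f = ∏ p(x_i,y_i) / (p(x_i) p(y_i))` and Jensen's inequality gives `n ·
info p ≤ log₂ M`. Couplings with first marginal `PX` form a compact set and `info` is continuous on
it, so the bounds pass to the limit (`isClosed_relaxedRegion`). Under the assured criterion, payoff
`-∞` may still occur with vanishing probability at finite `n`; a tolerance coordinate that tends to
zero takes care of this.

Achievability. Fix a feasible `p`, a message rate above `info p` and any positive key rate. Draw
codewords `yⁿ(m,k)` independently from the second marginal and let the encoder choose `m` with
probability proportional to the likelihood of `xⁿ` given `yⁿ(m,k)`. By soft covering over `m`, the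
code behaves as if `m` and `k` were uniform and `Xⁿ` came from `yⁿ(m,k)` through the reverse channel
(`abs_mean_codeLaw_sub_idealMean_le`). Averaging over `k` for fixed `m` makes each pair `(Y_i, Y_j)`
nearly a pair of independent samples; only polynomially many pairs matter, so exponentially many
keys suffice at any positive rate. Hence the message tells the adversary almost nothing about single
symbols, which settles the symbol-wise criterion (`le_idealMean_coordinate`). Pairwise
near-independence bounds the variance of the block payoff, and Chebyshev settles the assured
criterion (`idealMean_sq_le`). The absence of `W^{i-1}` from the strategies is what makes laws of
pairs sufficient.

For real payoffs the symbol-wise criterion implies the average one, which closes the circle of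
inclusions. -/

theorem sum_prod_weight (φ : ι → α → ℝ) :
    ∑ f : ι → α, ∏ l, φ l (f l) = ∏ l, ∑ a, φ l a := by
  classical
  rw [Finset.prod_univ_sum, Fintype.piFinset_univ]

theorem sum_prod_weight_eq_one {p : ι → α → ℝ} (hp : ∀ i, ∑ a, p i a = 1) :
    ∑ f : ι → α, ∏ l, p l (f l) = 1 := by
  rw [sum_prod_weight, Finset.prod_eq_one fun i _ => hp i]

theorem sum_prod_weight_mul {p : ι → α → ℝ} (hp : ∀ i, ∑ a, p i a = 1) (i : ι) (g : α → ℝ) :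
    ∑ f : ι → α, (∏ l, p l (f l)) * g (f i) = ∑ a, p i a * g a := by
  classical
  have h : ∀ f : ι → α, (∏ l, p l (f l)) * g (f i)
      = ∏ l, (p l (f l) * if l = i then g (f l) else 1) := by
    intro f
    rw [Finset.prod_mul_distrib, Finset.prod_ite_eq' Finset.univ i (fun l => g (f l))]
    simp
  simp_rw [h]
  rw [sum_prod_weight (fun l a => p l a * if l = i then g a else 1),
    Finset.prod_eq_single i (fun l _ hl => by simp [hl, hp]) (by simp)]
  simp

theorem sum_prod_weight_mul_mul {p : ι → α → ℝ} (hp : ∀ i, ∑ a, p i a = 1) {i j : ι}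
    (hij : i ≠ j) (g h : α → ℝ) :
    ∑ f : ι → α, (∏ l, p l (f l)) * (g (f i) * h (f j))
      = (∑ a, p i a * g a) * ∑ a, p j a * h a := by
  classical
  have key : ∀ f : ι → α, (∏ l, p l (f l)) * (g (f i) * h (f j))
      = ∏ l, (p l (f l) * ((if l = i then g (f l) else 1) * if l = j then h (f l) else 1)) := by
    intro f
    rw [Finset.prod_mul_distrib, Finset.prod_mul_distrib,
      Finset.prod_ite_eq' Finset.univ i (fun l => g (f l)),
      Finset.prod_ite_eq' Finset.univ j (fun l => h (f l))]
    simp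
  simp_rw [key]
  rw [sum_prod_weight (fun l a => p l a * ((if l = i then g a else 1) * if l = j then h a else 1)),
    ← Finset.prod_subset (Finset.subset_univ {i, j}), Finset.prod_pair hij]
  · simp [hij, hij.symm]
  · intro l _ hl
    simp only [Finset.mem_insert, Finset.mem_singleton, not_or] at hl
    simp [hl.1, hl.2, hp]

theorem sum_prod_weight_mul_sq {p : ι → α → ℝ} (hp : ∀ i, ∑ a, p i a = 1)
    (g : ι → α → ℝ) :
    ∑ f : ι → α, (∏ l, p l (f l)) * (∑ i, g i (f i)) ^ 2
      = ∑ i, ∑ j, if i = j then ∑ a, p i a * g i a ^ 2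
          else (∑ a, p i a * g i a) * ∑ a, p j a * g j a := by
  have h : ∀ f : ι → α, (∏ l, p l (f l)) * (∑ i, g i (f i)) ^ 2
      = ∑ i, ∑ j, (∏ l, p l (f l)) * (g i (f i) * g j (f j)) := by
    intro f
    rw [sq, Finset.sum_mul_sum, Finset.mul_sum]
    simp_rw [Finset.mul_sum]
  simp_rw [h]
  rw [Finset.sum_comm]
  refine Finset.sum_congr rfl fun i _ => ?_
  rw [Finset.sum_comm]
  refine Finset.sum_congr rfl fun j _ => ?_
  split_ifs with hij
  · subst hij
    rw [← sum_prod_weight_mul hp i (fun a => g i a ^ 2)]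
    simp_rw [sq]
  · exact sum_prod_weight_mul_mul hp hij _ _

theorem sum_prod_weight_mul_sq_of_centered {p : ι → α → ℝ} (hp : ∀ i, ∑ a, p i a = 1)
    {g : ι → α → ℝ} (hg : ∀ i, ∑ a, p i a * g i a = 0) :
    ∑ f : ι → α, (∏ l, p l (f l)) * (∑ i, g i (f i)) ^ 2 = ∑ i, ∑ a, p i a * g i a ^ 2 := by
  classical
  rw [sum_prod_weight_mul_sq hp]
  simp [hg]

/-- The Cauchy–Schwarz bound `E |h| ≤ √(E h²)` for finite weights of total mass one. -/
theorem sum_mul_abs_le_sqrt {w h : α → ℝ} (hw : ∀ a, 0 ≤ w a) (hw1 : ∑ a, w a = 1) :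
    ∑ a, w a * |h a| ≤ √(∑ a, w a * h a ^ 2) := by
  apply Real.le_sqrt_of_sq_le
  have h2 := Finset.sum_mul_sq_le_sq_mul_sq Finset.univ (fun a => √(w a)) (fun a => √(w a) * |h a|)
  have e : ∀ a, √(w a) * (√(w a) * |h a|) = w a * |h a| := fun a => by
    rw [← mul_assoc, Real.mul_self_sqrt (hw a)]
  simp_rw [e, mul_pow, Real.sq_sqrt (hw _), sq_abs, hw1, one_mul] at h2
  exact h2

/-- The mean absolute deviation of an empirical average over a subset `s` of independent samples. -/
theorem sum_prod_weight_mul_abs_average_sub_le {w : α → ℝ} (hw : ∀ a, 0 ≤ w a)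
    (hw1 : ∑ a, w a = 1) (s : Finset ι) (hs : s.Nonempty) (g : α → ℝ) :
    ∑ f : ι → α, (∏ l, w (f l)) * |(s.card : ℝ)⁻¹ * ∑ i ∈ s, g (f i) - ∑ a, w a * g a|
      ≤ √((∑ a, w a * g a ^ 2) / s.card) := by
  classical
  have hc : (0 : ℝ) < s.card := by exact_mod_cast hs.card_pos
  set μ := ∑ a, w a * g a with hμ
  refine (sum_mul_abs_le_sqrt (fun f => Finset.prod_nonneg fun l _ => hw _)
    (sum_prod_weight_eq_one (p := fun _ : ι => w) fun _ => hw1)).trans (Real.sqrt_le_sqrt ?_)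
  have e : ∀ f : ι → α, (s.card : ℝ)⁻¹ * ∑ i ∈ s, g (f i) - μ
      = ∑ i, if i ∈ s then (s.card : ℝ)⁻¹ * (g (f i) - μ) else 0 := by
    intro f
    rw [Finset.sum_ite_mem, Finset.univ_inter, ← Finset.mul_sum, Finset.sum_sub_distrib]
    simp only [Finset.sum_const, nsmul_eq_mul]
    field_simp
  simp_rw [e]
  have hcen : ∑ a, w a * (g a - μ) = 0 := by
    simp_rw [mul_sub, Finset.sum_sub_distrib, ← Finset.sum_mul, hw1]
    simp [hμ]
  rw [sum_prod_weight_mul_sq_of_centered (p := fun _ : ι => w) (fun _ => hw1)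
    (g := fun i a => if i ∈ s then (s.card : ℝ)⁻¹ * (g a - μ) else 0)]
  · have hv : ∑ a, w a * (g a - μ) ^ 2 ≤ ∑ a, w a * g a ^ 2 := by
      have : ∑ a, w a * (g a - μ) ^ 2 = ∑ a, w a * g a ^ 2 - μ ^ 2 := by
        have : ∀ a, w a * (g a - μ) ^ 2 = w a * g a ^ 2 - 2 * μ * (w a * g a) + μ ^ 2 * w a :=
          fun a => by ring
        simp_rw [this, Finset.sum_add_distrib, Finset.sum_sub_distrib, ← Finset.mul_sum, hw1, ← hμ]
        ring
      nlinarith [sq_nonneg μ]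
    have : ∀ i : ι, ∑ a, w a * (if i ∈ s then (s.card : ℝ)⁻¹ * (g a - μ) else 0) ^ 2
        = if i ∈ s then (s.card : ℝ)⁻¹ ^ 2 * ∑ a, w a * (g a - μ) ^ 2 else 0 := by
      intro i
      split_ifs
      · rw [Finset.mul_sum]
        exact Finset.sum_congr rfl fun a _ => by ring
      · simp
    simp_rw [this]
    rw [Finset.sum_ite_mem, Finset.univ_inter, Finset.sum_const, nsmul_eq_mul, div_eq_inv_mul]
    calc (s.card : ℝ) * ((s.card : ℝ)⁻¹ ^ 2 * ∑ a, w a * (g a - μ) ^ 2)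
        = (s.card : ℝ)⁻¹ * ∑ a, w a * (g a - μ) ^ 2 := by field_simp
      _ ≤ _ := by gcongr
  · intro i
    split_ifs
    · have : ∀ a, w a * ((s.card : ℝ)⁻¹ * (g a - μ)) = (s.card : ℝ)⁻¹ * (w a * (g a - μ)) :=
        fun a => by ring
      simp_rw [this, ← Finset.mul_sum, hcen, mul_zero]
    · simp

/-- The averaging step of random coding. Positivity of the weight is kept because it later forces
all codeword letters into the support of the marginal. -/
theorem exists_pos_weight_le {w F : α → ℝ} (hw : ∀ a, 0 ≤ w a) (hw1 : ∑ a, w a = 1) {b : ℝ}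
    (hF : ∑ a, w a * F a ≤ b) : ∃ a, 0 < w a ∧ F a ≤ b := by
  by_contra! hcon
  have h1 : ∑ a, w a * b < ∑ a, w a * F a := by
    have hex : ∃ a ∈ Finset.univ, w a ≠ 0 := by
      by_contra! h0
      rw [Finset.sum_eq_zero h0] at hw1
      exact zero_ne_one hw1
    obtain ⟨a, _, ha⟩ := hex
    have hpos : ∀ a, w a ≠ 0 → 0 < w a := fun a h => lt_of_le_of_ne (hw a) h.symm
    refine Finset.sum_lt_sum (fun a _ => ?_) ⟨a, Finset.mem_univ _, ?_⟩
    · by_cases h : w a = 0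
      · simp [h]
      · exact mul_le_mul_of_nonneg_left (hcon a (hpos a h)).le (hw a)
    · exact mul_lt_mul_of_pos_left (hcon a (hpos a ha)) (hpos a ha)
  rw [← Finset.sum_mul, hw1, one_mul] at h1
  linarith

end ProductMoments

/-! ### Real expectations and their relation to extended-real ones -/

section Mean

/-- The expectation of a real-valued function of a random variable with a finite alphabet. -/
def mean {Ω : Type*} [Fintype Ω] (p : PMF Ω) (f : Ω → ℝ) : ℝ := ∑ ω, (p ω).toReal * f ω

variable {Ω Ω' : Type*} [Fintype Ω] [Fintype Ω']

theorem sum_toReal_eq_one (p : PMF Ω) : ∑ ω, (p ω).toReal = 1 := by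
  rw [← ENNReal.toReal_sum fun ω _ => p.apply_ne_top ω,
    ← tsum_fintype (L := .unconditional _), p.tsum_coe]
  rfl

theorem mean_const (p : PMF Ω) (a : ℝ) : mean p (fun _ => a) = a := by
  rw [mean, ← Finset.sum_mul, sum_toReal_eq_one, one_mul]

theorem mean_mono (p : PMF Ω) {f g : Ω → ℝ} (h : ∀ ω, p ω ≠ 0 → f ω ≤ g ω) :
    mean p f ≤ mean p g := by
  refine Finset.sum_le_sum fun ω _ => ?_
  by_cases h0 : p ω = 0
  · simp [h0]
  · exact mul_le_mul_of_nonneg_left (h ω h0) ENNReal.toReal_nonneg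

theorem mean_bind (p : PMF Ω) (q : Ω → PMF Ω') (f : Ω' → ℝ) :
    mean (p.bind q) f = mean p fun ω => mean (q ω) f := by
  simp only [mean, PMF.bind_apply, tsum_fintype, Finset.mul_sum]
  rw [Finset.sum_comm]
  refine Finset.sum_congr rfl fun b _ => ?_
  rw [ENNReal.toReal_sum fun a _ => ENNReal.mul_ne_top (p.apply_ne_top a) ((q a).apply_ne_top b),
    Finset.sum_mul]
  refine Finset.sum_congr rfl fun a _ => ?_
  rw [ENNReal.toReal_mul, mul_assoc]

theorem mean_pure (a : Ω) (f : Ω → ℝ) : mean (PMF.pure a) f = f a := by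
  classical
  simp [mean, PMF.pure_apply, apply_ite ENNReal.toReal]

theorem mean_map (p : PMF Ω) (g : Ω → Ω') (f : Ω' → ℝ) :
    mean (p.map g) f = mean p fun ω => f (g ω) := by
  rw [PMF.map, mean_bind]
  simp [mean_pure]

theorem mean_add (p : PMF Ω) (f g : Ω → ℝ) :
    mean p (fun ω => f ω + g ω) = mean p f + mean p g := by
  simp [mean, mul_add, Finset.sum_add_distrib]

theorem mean_mul_left (p : PMF Ω) (a : ℝ) (f : Ω → ℝ) :
    mean p (fun ω => a * f ω) = a * mean p f := by
  simp only [mean, Finset.mul_sum]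
  exact Finset.sum_congr rfl fun ω _ => by ring

theorem mean_sum {ι : Type*} (s : Finset ι) (p : PMF Ω) (f : ι → Ω → ℝ) :
    mean p (fun ω => ∑ i ∈ s, f i ω) = ∑ i ∈ s, mean p (f i) := by
  simp only [mean, Finset.mul_sum]
  rw [Finset.sum_comm]

theorem apply_toReal_eq_mean [DecidableEq Ω] (p : PMF Ω) (a : Ω) :
    (p a).toReal = mean p fun ω => if ω = a then 1 else 0 := by
  simp [mean]

theorem toOuterMeasure_toReal (p : PMF Ω) (s : Set Ω) [DecidablePred (· ∈ s)] :
    (p.toOuterMeasure s).toReal = mean p fun ω => if ω ∈ s then 1 else 0 := by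
  rw [PMF.toOuterMeasure_apply_fintype, ENNReal.toReal_sum]
  · simp only [mean]
    refine Finset.sum_congr rfl fun ω _ => ?_
    by_cases h : ω ∈ s <;> simp [h]
  · intro ω _
    by_cases h : ω ∈ s <;> simp [h, p.apply_ne_top]

theorem ereal_coe_sum {ι : Type*} (s : Finset ι) (f : ι → ℝ) :
    ((∑ i ∈ s, f i : ℝ) : EReal) = ∑ i ∈ s, (f i : EReal) := by
  classical
  induction s using Finset.induction_on with
  | empty => simp
  | insert a s ha ih => simp [Finset.sum_insert ha, ih]

theorem ereal_sum_eq_bot {ι : Type*} {s : Finset ι} {f : ι → EReal} {i : ι} (hi : i ∈ s)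
    (h : f i = ⊥) : ∑ i ∈ s, f i = ⊥ := by
  classical
  rw [← Finset.add_sum_erase s f hi, h, EReal.bot_add]

/-- Because `0 * (-∞) = 0` while any positive mass on `-∞` absorbs the whole sum, an extended-real
bound splits into a support condition and a real inequality. All later work is with real sums. -/
theorem coe_le_expect_iff (p : PMF Ω) {f : Ω → EReal} (hf : ∀ ω, f ω ≠ ⊤) (a : ℝ) :
    (a : EReal) ≤ expect p f ↔
      (∀ ω, f ω = ⊥ → p ω = 0) ∧ a ≤ mean p fun ω => (f ω).toReal := by
  by_cases h : ∀ ω, f ω = ⊥ → p ω = 0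
  · have : expect p f = ((mean p fun ω => (f ω).toReal : ℝ) : EReal) := by
      rw [expect, mean, ereal_coe_sum]
      refine Finset.sum_congr rfl fun ω _ => ?_
      by_cases hb : f ω = ⊥
      · simp [h ω hb]
      · rw [EReal.coe_mul, EReal.coe_toReal (hf ω) hb, EReal.coe_ennreal_toReal (p.apply_ne_top ω)]
    rw [this, EReal.coe_le_coe_iff]
    exact ⟨fun h' => ⟨h, h'⟩, fun h' => h'.2⟩
  · refine iff_of_false ?_ fun h' => h h'.1
    push Not at h
    obtain ⟨ω, hb, h0⟩ := h
    rw [expect, ereal_sum_eq_bot (Finset.mem_univ ω)]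
    · simp
    · rw [hb, ← EReal.coe_ennreal_toReal (p.apply_ne_top ω)]
      exact EReal.coe_mul_bot_of_pos (ENNReal.toReal_pos h0 (p.apply_ne_top ω))

theorem coe_le_inv_mul_sum_iff {n : ℕ} (hn : 0 < n) {f : Fin n → EReal} (hf : ∀ i, f i ≠ ⊤)
    (a : ℝ) : (a : EReal) ≤ (((n : ℝ)⁻¹ : ℝ) : EReal) * ∑ i, f i ↔
      (∀ i, f i ≠ ⊥) ∧ a ≤ (n : ℝ)⁻¹ * ∑ i, (f i).toReal := by
  by_cases h : ∀ i, f i ≠ ⊥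
  · have : ∑ i, f i = ((∑ i, (f i).toReal : ℝ) : EReal) := by
      rw [ereal_coe_sum]
      exact Finset.sum_congr rfl fun i _ => (EReal.coe_toReal (hf i) (h i)).symm
    rw [this, ← EReal.coe_mul, EReal.coe_le_coe_iff]
    exact ⟨fun h' => ⟨h, h'⟩, fun h' => h'.2⟩
  · refine iff_of_false ?_ fun h' => h h'.1
    push Not at h
    obtain ⟨i, hi⟩ := h
    rw [ereal_sum_eq_bot (Finset.mem_univ i) hi, EReal.coe_mul_bot_of_pos (by positivity)]
    simp

theorem mean_productPMF_mul {n : ℕ} (p : Fin n → PMF Ω) (i : Fin n) (g : Ω → ℝ) :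
    mean (productPMF p) (fun f => g (f i)) = mean (p i) g := by
  have := sum_prod_weight_mul (p := fun i a => (p i a).toReal) (fun i => sum_toReal_eq_one _) i g
  rw [mean, mean, ← this]
  refine Finset.sum_congr rfl fun f _ => ?_
  rw [← ENNReal.toReal_prod]
  rfl

end Mean

/-! ### Product distributions through memoryless channels -/

section ProductPMF

theorem tsum_prod_eq_prod_tsum {α : Type*} : ∀ (n : ℕ) (φ : Fin n → α → ℝ≥0∞),
    ∑' f : Fin n → α, ∏ i, φ i (f i) = ∏ i, ∑' a, φ i a := by
  intro n
  induction n with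
  | zero =>
    intro φ
    rw [tsum_eq_single (fun i => i.elim0) (fun b hb => absurd (Subsingleton.elim _ _) hb)]
    simp
  | succ n ih =>
    intro φ
    rw [← (Fin.consEquiv (fun _ : Fin (n + 1) => α)).tsum_eq, ENNReal.tsum_prod']
    simp only [Fin.consEquiv_apply, Fin.prod_univ_succ, Fin.cons_zero, Fin.cons_succ,
      ENNReal.tsum_mul_left, ih (fun i => φ i.succ), ENNReal.tsum_mul_right]

theorem productPMF_bind {α β : Type*} {n : ℕ} (p : Fin n → PMF α) (q : Fin n → α → PMF β) :
    ((productPMF p).bind fun w : Fin n → α => productPMF fun i => q i (w i))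
      = productPMF fun i => (p i).bind (q i) := by
  ext f
  rw [PMF.bind_apply]
  change ∑' w : Fin n → α, (∏ i, p i (w i)) * ∏ i, q i (w i) (f i) = ∏ i, (p i).bind (q i) (f i)
  simp only [← Finset.prod_mul_distrib, PMF.bind_apply]
  exact tsum_prod_eq_prod_tsum n fun i a => p i a * q i a (f i)

theorem productPMF_bind_coordinate {α β : Type*} {n : ℕ} (p : Fin n → PMF α) (i : Fin n)
    (h : α → PMF β) : ((productPMF p).bind fun w : Fin n → α => h (w i)) = (p i).bind h := by
  ext b
  rw [PMF.bind_apply, PMF.bind_apply]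
  have key : ∀ w : Fin n → α, productPMF p w * h (w i) b
      = ∏ l, (p l (w l) * if l = i then h (w l) b else 1) := by
    intro w
    rw [Finset.prod_mul_distrib, Finset.prod_ite_eq' Finset.univ i fun l => h (w l) b]
    simp [productPMF]
    rfl
  simp_rw [key]
  rw [tsum_prod_eq_prod_tsum n fun l a => p l a * if l = i then h a b else 1,
    Finset.prod_eq_single i (fun l _ hl => by simp [hl, PMF.tsum_coe]) (by simp)]
  simp

end ProductPMF

/-! ### Eliminating the disclosed symbols -/

section Laws

variable {X Y Z Wx Wy : Type*} {n : ℕ} {R R₀ : ℝ}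

/-- The channel from `(X, Y)` to `Z` that results from drawing `Z` from `s` given `(W_x, W_y)`. -/
def effectiveChannel (PWx : X → PMF Wx) (PWy : Y → PMF Wy) (s : Wx × Wy → PMF Z) (x : X) (y : Y) :
    PMF Z :=
  (PWx x).bind fun wx => (PWy y).bind fun wy => s (wx, wy)

/-- The joint law of `(Xⁿ, Yⁿ, M)`. -/
def codeLaw (PX : PMF X) (c : Code X Y n R R₀) :
    PMF ((Fin n → X) × (Fin n → Y) × Fin (indexSize n R)) :=
  (productPMF fun _ : Fin n => PX).bind fun x =>
  c.keyLaw.bind fun k =>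
  (c.encoder x k).bind fun m =>
  (c.decoder m k).bind fun y =>
  PMF.pure (x, y, m)

/-- Since `Z_i` depends on `W^n` only through `W_i`, the disclosures can be averaged out coordinate
by coordinate: given `(xⁿ, yⁿ, m)` the actions are independent. Afterwards only finite alphabets
remain, although those of `W` are arbitrary. -/
theorem blockLaw_eq (PX : PMF X) (PWx : X → PMF Wx) (PWy : Y → PMF Wy) (c : Code X Y n R R₀)
    (s : Fin n → Fin (indexSize n R) → Wx × Wy → PMF Z) :
    blockLaw PX PWx PWy c s = (codeLaw PX c).bind fun t =>
      (productPMF fun i => effectiveChannel PWx PWy (s i t.2.2) (t.1 i) (t.2.1 i)).map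
        fun z => (t.1, t.2.1, z) := by
  simp only [blockLaw, systemLaw, codeLaw, PMF.bind_bind, PMF.pure_bind, effectiveChannel]
  congr! 8 with x k m y
  rw [← productPMF_bind (fun i => PWx (x i)) fun i wx => (PWy (y i)).bind fun wy => s i m (wx, wy),
    PMF.map_bind]
  congr! 2 with wx
  rw [← productPMF_bind (fun i => PWy (y i)) fun i wy => s i m (wx i, wy), PMF.map_bind]

theorem symbolLaw_eq (PX : PMF X) (PWx : X → PMF Wx) (PWy : Y → PMF Wy) (c : Code X Y n R R₀)
    (i : Fin n) (s : Fin (indexSize n R) → Wx × Wy → PMF Z) :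
    symbolLaw PX PWx PWy c i s = (codeLaw PX c).bind fun t =>
      (effectiveChannel PWx PWy (s t.2.2) (t.1 i) (t.2.1 i)).map
        fun z => (t.1 i, t.2.1 i, z) := by
  simp only [symbolLaw, systemLaw, codeLaw, PMF.bind_bind, PMF.pure_bind, effectiveChannel]
  congr! 8 with x k m y
  rw [PMF.map_bind, ← productPMF_bind_coordinate (fun i => PWx (x i)) i]
  congr! 2 with wx
  rw [PMF.map_bind, ← productPMF_bind_coordinate (fun i => PWy (y i)) i]

theorem singleLetterLaw_eq (PX : PMF X) (PWx : X → PMF Wx) (PWy : Y → PMF Wy) (PY : X → PMF Y)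
    (z : Wx × Wy → Z) :
    singleLetterLaw PX PWx PWy PY z = (jointLaw PX PY).bind fun t =>
      (effectiveChannel PWx PWy (fun w => PMF.pure (z w)) t.1 t.2).map fun z => (t.1, t.2, z) := by
  simp only [singleLetterLaw, effectiveChannel, PMF.map_bind, PMF.pure_map]

theorem blockPayoff_eq_coe {π : X → Y → Z → EReal} (htop : ∀ x y z, π x y z ≠ ⊤)
    (hbot : ∀ x y z, π x y z ≠ ⊥) (ω : (Fin n → X) × (Fin n → Y) × (Fin n → Z)) :
    blockPayoff π ω
      = (((n : ℝ)⁻¹ * ∑ i, (π (ω.1 i) (ω.2.1 i) (ω.2.2 i)).toReal : ℝ) : EReal) := by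
  rw [blockPayoff, EReal.coe_mul, ereal_coe_sum]
  simp only [EReal.coe_toReal (htop _ _ _) (hbot _ _ _)]

variable [Fintype X] [Fintype Y] [Fintype Z]

theorem mean_blockLaw (PX : PMF X) (PWx : X → PMF Wx) (PWy : Y → PMF Wy) (c : Code X Y n R R₀)
    (s : Fin n → Fin (indexSize n R) → Wx × Wy → PMF Z)
    (f : (Fin n → X) × (Fin n → Y) × (Fin n → Z) → ℝ) :
    mean (blockLaw PX PWx PWy c s) f = mean (codeLaw PX c) fun t =>
      mean (productPMF fun i => effectiveChannel PWx PWy (s i t.2.2) (t.1 i) (t.2.1 i))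
        fun z => f (t.1, t.2.1, z) := by
  rw [blockLaw_eq, mean_bind]
  simp_rw [mean_map]

theorem mean_symbolLaw (PX : PMF X) (PWx : X → PMF Wx) (PWy : Y → PMF Wy) (c : Code X Y n R R₀)
    (i : Fin n) (s : Fin (indexSize n R) → Wx × Wy → PMF Z) (f : X × Y × Z → ℝ) :
    mean (symbolLaw PX PWx PWy c i s) f = mean (codeLaw PX c) fun t =>
      mean (effectiveChannel PWx PWy (s t.2.2) (t.1 i) (t.2.1 i))
        fun z => f (t.1 i, t.2.1 i, z) := by
  rw [symbolLaw_eq, mean_bind]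
  simp_rw [mean_map]

theorem mean_blockLaw_average (PX : PMF X) (PWx : X → PMF Wx) (PWy : Y → PMF Wy)
    (c : Code X Y n R R₀) (s : Fin n → Fin (indexSize n R) → Wx × Wy → PMF Z)
    (f : X → Y → Z → ℝ) :
    mean (blockLaw PX PWx PWy c s) (fun ω => (n : ℝ)⁻¹ * ∑ i, f (ω.1 i) (ω.2.1 i) (ω.2.2 i))
      = (n : ℝ)⁻¹ * ∑ i, mean (symbolLaw PX PWx PWy c i (s i))
          fun ω => f ω.1 ω.2.1 ω.2.2 := by
  rw [mean_mul_left, mean_sum]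
  congr 1
  refine Finset.sum_congr rfl fun i _ => ?_
  rw [mean_blockLaw, mean_symbolLaw]
  congr 1
  funext t
  exact mean_productPMF_mul _ i fun z => f (t.1 i) (t.2.1 i) z

theorem coe_le_expect_blockLaw_iff {π : X → Y → Z → EReal} (htop : ∀ x y z, π x y z ≠ ⊤)
    (hbot : ∀ x y z, π x y z ≠ ⊥) (PX : PMF X) (PWx : X → PMF Wx) (PWy : Y → PMF Wy)
    (c : Code X Y n R R₀) (s : Fin n → Fin (indexSize n R) → Wx × Wy → PMF Z) (a : ℝ) :
    (a : EReal) ≤ expect (blockLaw PX PWx PWy c s) (blockPayoff π) ↔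
      a ≤ (n : ℝ)⁻¹ * ∑ i, mean (symbolLaw PX PWx PWy c i (s i))
          fun ω => (π ω.1 ω.2.1 ω.2.2).toReal := by
  rw [funext (blockPayoff_eq_coe (n := n) htop hbot),
    coe_le_expect_iff _ (fun ω => EReal.coe_ne_top _)]
  simp only [EReal.coe_ne_bot, EReal.toReal_coe, false_imp_iff, implies_true, true_and]
  rw [mean_blockLaw_average PX PWx PWy c s fun x y z => (π x y z).toReal]

/-- By linearity the expected block payoff is the average of the symbol payoffs, each facing its own
strategy `s i`, and each is at least the symbol-wise minimum. -/
theorem AchievableMin.achievableAvg {PX : PMF X} {PWx : X → PMF Wx} {PWy : Y → PMF Wy}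
    {π : X → Y → Z → EReal} (htop : ∀ x y z, π x y z ≠ ⊤) (hbot : ∀ x y z, π x y z ≠ ⊥)
    {P : ℝ} (h : AchievableMin PX PWx PWy π R R₀ P) : AchievableAvg PX PWx PWy π R R₀ P := by
  obtain ⟨c, hc⟩ := h
  refine ⟨c, hc.trans (liminf_le_liminf ?_)⟩
  filter_upwards [eventually_gt_atTop 0] with n hn
  refine le_iInf fun s => EReal.ge_of_forall_gt_iff_ge.1 fun a ha => ?_
  have hi : ∀ i, a ≤ mean (symbolLaw PX PWx PWy (c n) i (s i))
      fun ω => (π ω.1 ω.2.1 ω.2.2).toReal := fun i =>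
    ((coe_le_expect_iff _ (fun ω => htop _ _ _) a).1
      (ha.le.trans ((iInf_le _ i).trans (iInf_le _ (s i))))).2
  have hn' : (0 : ℝ) < n := by exact_mod_cast hn
  rw [coe_le_expect_blockLaw_iff htop hbot, le_inv_mul_iff₀ hn']
  calc (n : ℝ) * a = ∑ _i : Fin n, a := by simp
    _ ≤ _ := Finset.sum_le_sum fun i _ => hi i

end Laws

/-! ### Bounds and constructions for finite distributions -/

section Finite

variable {Ω Ω' : Type*} [Fintype Ω] [Fintype Ω']

theorem mean_comm (p : PMF Ω) (q : PMF Ω') (f : Ω → Ω' → ℝ) :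
    (mean p fun a => mean q fun b => f a b) = mean q fun b => mean p fun a => f a b := by
  simp only [mean, Finset.mul_sum]
  rw [Finset.sum_comm]
  exact Finset.sum_congr rfl fun b _ => Finset.sum_congr rfl fun a _ => by ring

theorem toReal_le_one {Ω : Type*} (p : PMF Ω) (a : Ω) : (p a).toReal ≤ 1 :=
  ENNReal.toReal_le_of_le_ofReal zero_le_one (by simpa using p.coe_le_one a)

theorem mean_le_sum (p : PMF Ω) {f : Ω → ℝ} (hf : ∀ a, 0 ≤ f a) : mean p f ≤ ∑ a, f a :=
  Finset.sum_le_sum fun a _ => mul_le_of_le_one_left (hf a) (toReal_le_one p a)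

theorem toReal_productPMF {Ω : Type*} {n : ℕ} (p : Fin n → PMF Ω) (f : Fin n → Ω) :
    (productPMF p f).toReal = ∏ i, (p i (f i)).toReal := by
  rw [← ENNReal.toReal_prod]
  rfl

theorem toOuterMeasure_le_one {Ω : Type*} (p : PMF Ω) (s : Set Ω) : p.toOuterMeasure s ≤ 1 :=
  (p.toOuterMeasure_mono (Set.subset_univ _)).trans
    ((p.toOuterMeasure_apply_eq_one_iff Set.univ).2 (Set.subset_univ _)).le

theorem exists_pmf_toReal_eq {w : Ω → ℝ} (hw : ∀ a, 0 ≤ w a) (hw1 : ∑ a, w a = 1) :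
    ∃ q : PMF Ω, ∀ a, (q a).toReal = w a := by
  refine ⟨PMF.ofFintype (fun a => ENNReal.ofReal (w a)) ?_, fun a => ?_⟩
  · rw [← ENNReal.ofReal_sum_of_nonneg fun a _ => hw a, hw1, ENNReal.ofReal_one]
  · rw [PMF.ofFintype_apply, ENNReal.toReal_ofReal (hw a)]

end Finite

/-! ### Nonnegativity and continuity of mutual information -/

section Information

variable {X Y : Type*} [Fintype X] [Fintype Y]

/-- Mutual information, in bits, of a matrix of joint probabilities. -/
def info (p : X → Y → ℝ) : ℝ :=
  ∑ x, ∑ y, p x y * Real.logb 2 (p x y / ((∑ y', p x y') * ∑ x', p x' y))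

theorem toReal_jointLaw (PX : PMF X) (PY : X → PMF Y) (x : X) (y : Y) :
    (jointLaw PX PY (x, y)).toReal = (PX x).toReal * (PY x y).toReal := by
  classical
  rw [apply_toReal_eq_mean, jointLaw, mean_bind]
  simp only [mean_map, Prod.mk.injEq]
  simp only [mean, ite_and, mul_ite, mul_one, mul_zero, Finset.sum_ite_irrel,
    Finset.sum_const_zero, Finset.sum_ite_eq', Finset.mem_univ, if_true]

theorem sum_toReal_jointLaw {X : Type*} (PX : PMF X) (PY : X → PMF Y) (x : X) :
    ∑ y, (PX x).toReal * (PY x y).toReal = (PX x).toReal := by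
  rw [← Finset.mul_sum, sum_toReal_eq_one, mul_one]

theorem mutualInfo_eq_info (p : PMF (X × Y)) :
    mutualInfo p = info fun x y => (p (x, y)).toReal := by
  classical
  have h1 : ∀ x, (p.map Prod.fst x).toReal = ∑ y, (p (x, y)).toReal := fun x => by
    rw [apply_toReal_eq_mean, mean_map, mean, Fintype.sum_prod_type]
    simp [Finset.sum_ite_irrel]
  have h2 : ∀ y, (p.map Prod.snd y).toReal = ∑ x, (p (x, y)).toReal := fun y => by
    rw [apply_toReal_eq_mean, mean_map, mean, Fintype.sum_prod_type]
    simp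
  simp only [mutualInfo, info, h1, h2]

/-- From `log t ≥ 1 - 1/t`, each summand dominates `(p x y - p x · p y) / log 2`, and these
differences sum to zero. -/
theorem info_nonneg {p : X → Y → ℝ} (hp : ∀ x y, 0 ≤ p x y) (hp1 : ∑ x, ∑ y, p x y = 1) :
    0 ≤ info p := by
  have h : ∀ x y, (p x y - (∑ y', p x y') * ∑ x', p x' y) / Real.log 2
      ≤ p x y * Real.logb 2 (p x y / ((∑ y', p x y') * ∑ x', p x' y)) := by
    intro x y
    have hl : 0 < Real.log 2 := Real.log_pos (by norm_num)
    rw [Real.logb, ← mul_div_assoc]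
    refine div_le_div_of_nonneg_right ?_ hl.le
    have ha : 0 ≤ ∑ y', p x y' := Finset.sum_nonneg fun _ _ => hp _ _
    have hb : 0 ≤ ∑ x', p x' y := Finset.sum_nonneg fun _ _ => hp _ _
    rcases (hp x y).eq_or_lt with h0 | h0
    · rw [← h0]; simp; positivity
    have ha' : 0 < ∑ y', p x y' := h0.trans_le
      (Finset.single_le_sum (f := fun y' => p x y') (fun _ _ => hp _ _) (Finset.mem_univ y))
    have hb' : 0 < ∑ x', p x' y := h0.trans_le
      (Finset.single_le_sum (f := fun x' => p x' y) (fun _ _ => hp _ _) (Finset.mem_univ x))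
    have := Real.one_sub_inv_le_log_of_pos (div_pos h0 (mul_pos ha' hb'))
    calc p x y - (∑ y', p x y') * ∑ x', p x' y
        = p x y * (1 - (p x y / ((∑ y', p x y') * ∑ x', p x' y))⁻¹) := by
          rw [inv_div]; field_simp
      _ ≤ _ := by gcongr
  calc (0 : ℝ) = ∑ x, ∑ y, (p x y - (∑ y', p x y') * ∑ x', p x' y) / Real.log 2 := by
        simp only [← Finset.sum_div, Finset.sum_sub_distrib, ← Finset.mul_sum, hp1]
        rw [Finset.sum_comm (f := fun y x => p x y), hp1, ← Finset.sum_mul, hp1]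
        simp
    _ ≤ info p := Finset.sum_le_sum fun x _ => Finset.sum_le_sum fun y _ => h x y

/-- On nonnegative matrices `info` is a combination of terms `t log t`, which are continuous also at
zero; the ratio inside the logarithm is not. -/
theorem continuousOn_info : ContinuousOn (info : (X → Y → ℝ) → ℝ) {p | ∀ x y, 0 ≤ p x y} := by
  have h : ∀ p ∈ {p : X → Y → ℝ | ∀ x y, 0 ≤ p x y}, info p =
      ((∑ x, ∑ y, p x y * Real.log (p x y)) - (∑ x, (∑ y, p x y) * Real.log (∑ y, p x y))
        - ∑ y, (∑ x, p x y) * Real.log (∑ x, p x y)) / Real.log 2 := by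
    intro p hp
    have key : ∀ x y, p x y * Real.logb 2 (p x y / ((∑ y', p x y') * ∑ x', p x' y))
        = (p x y * Real.log (p x y) - p x y * Real.log (∑ y', p x y')
          - p x y * Real.log (∑ x', p x' y)) / Real.log 2 := by
      intro x y
      rcases (hp x y).eq_or_lt with h0 | h0
      · rw [← h0]; simp
      have ha' : 0 < ∑ y', p x y' := h0.trans_le
        (Finset.single_le_sum (f := fun y' => p x y') (fun _ _ => hp _ _) (Finset.mem_univ y))
      have hb' : 0 < ∑ x', p x' y := h0.trans_le
        (Finset.single_le_sum (f := fun x' => p x' y) (fun _ _ => hp _ _) (Finset.mem_univ x))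
      rw [Real.logb, Real.log_div h0.ne' (mul_pos ha' hb').ne', Real.log_mul ha'.ne' hb'.ne']
      ring
    simp only [info, key]
    simp only [← Finset.sum_div, Finset.sum_sub_distrib]
    rw [Finset.sum_comm (f := fun x y => p x y * Real.log (∑ x', p x' y))]
    simp only [Finset.sum_mul]
  refine ContinuousOn.congr (Continuous.continuousOn ?_) h
  have hc : ∀ f : (X → Y → ℝ) → ℝ, Continuous f → Continuous fun p => f p * Real.log (f p) :=
    fun f hf => Real.continuous_mul_log.comp hf
  refine Continuous.div_const (Continuous.sub (Continuous.sub ?_ ?_) ?_) _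
  · exact continuous_finsetSum _ fun x _ => continuous_finsetSum _ fun y _ =>
      hc (fun p => p x y) (by fun_prop)
  · exact continuous_finsetSum _ fun x _ => hc (fun p => ∑ y, p x y) (by fun_prop)
  · exact continuous_finsetSum _ fun y _ => hc (fun p => ∑ x, p x y) (by fun_prop)

end Information

/-! ### Converse: the rate bound for the time-averaged law -/

section Converse

variable {X Y : Type*} [Fintype X] [Fintype Y] {n : ℕ} {R R₀ : ℝ}

theorem mean_codeLaw (PX : PMF X) (c : Code X Y n R R₀)
    (f : (Fin n → X) × (Fin n → Y) × Fin (indexSize n R) → ℝ) :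
    mean (codeLaw PX c) f = mean (productPMF fun _ : Fin n => PX) fun x => mean c.keyLaw fun k =>
      mean (c.encoder x k) fun m => mean (c.decoder m k) fun y => f (x, y, m) := by
  simp only [codeLaw, mean_bind, mean_pure]

/-- A change of measure: a message of `indexSize n R` values multiplies the expectation of a
nonnegative function by at most `indexSize n R`, compared with independent `Xⁿ` and `Yⁿ`. -/
theorem mean_codeLaw_le (PX : PMF X) (c : Code X Y n R R₀) {f : (Fin n → X) → (Fin n → Y) → ℝ}
    (hf : ∀ x y, 0 ≤ f x y)
    (hf1 : ∀ y, mean (productPMF fun _ : Fin n => PX) (fun x => f x y) ≤ 1) :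
    mean (codeLaw PX c) (fun t => f t.1 t.2.1) ≤ indexSize n R := by
  have hnn : ∀ (m : Fin (indexSize n R)) k x, 0 ≤ mean (c.decoder m k) fun y => f x y :=
    fun m k x => Finset.sum_nonneg fun y _ => mul_nonneg ENNReal.toReal_nonneg (hf x y)
  rw [mean_codeLaw]
  -- Replacing the encoder probability by one decouples `m` from `x`, so the source can be averaged
  -- first with the codeword fixed.
  calc _ ≤ mean (productPMF fun _ : Fin n => PX) fun x => mean c.keyLaw fun k =>
          ∑ m, mean (c.decoder m k) fun y => f x y :=
        mean_mono _ fun x _ => mean_mono _ fun k _ => mean_le_sum _ fun m => hnn m k x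
    _ = mean c.keyLaw fun k => ∑ m, mean (c.decoder m k) fun y =>
          mean (productPMF fun _ : Fin n => PX) fun x => f x y := by
        rw [mean_comm]
        simp only [mean_sum]
        congr! 3 with k m
        rw [mean_comm]
    _ ≤ mean c.keyLaw fun _ => ∑ _m : Fin (indexSize n R), (1 : ℝ) :=
        mean_mono _ fun k _ => Finset.sum_le_sum fun m _ =>
          (mean_mono _ fun y _ => hf1 y).trans (mean_const _ 1).le
    _ = indexSize n R := by rw [mean_const]; simp

open Classical in
/-- The time-averaged joint law of `(X_i, Y_i)`. -/
def averageLaw (PX : PMF X) (c : Code X Y n R R₀) (x : X) (y : Y) : ℝ :=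
  mean (codeLaw PX c) fun t => (n : ℝ)⁻¹ * ∑ i, if t.1 i = x ∧ t.2.1 i = y then 1 else 0

theorem averageLaw_nonneg (PX : PMF X) (c : Code X Y n R R₀) (x : X) (y : Y) :
    0 ≤ averageLaw PX c x y := by
  classical
  rw [averageLaw]
  refine Finset.sum_nonneg fun t _ => mul_nonneg ENNReal.toReal_nonneg
    (mul_nonneg (by positivity) (Finset.sum_nonneg fun i _ => ?_))
  split_ifs <;> norm_num

theorem sum_averageLaw_mul (PX : PMF X) (c : Code X Y n R R₀) (g : X → Y → ℝ) :
    ∑ x, ∑ y, averageLaw PX c x y * g x y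
      = mean (codeLaw PX c) fun t => (n : ℝ)⁻¹ * ∑ i, g (t.1 i) (t.2.1 i) := by
  classical
  have h : ∀ t : (Fin n → X) × (Fin n → Y) × Fin (indexSize n R),
      (n : ℝ)⁻¹ * ∑ i, g (t.1 i) (t.2.1 i) = ∑ x, ∑ y,
        g x y * ((n : ℝ)⁻¹ * ∑ i, if t.1 i = x ∧ t.2.1 i = y then 1 else 0) := by
    intro t
    simp only [Finset.mul_sum]
    simp_rw [Finset.sum_comm (s := (Finset.univ : Finset Y))]
    rw [Finset.sum_comm]
    refine Finset.sum_congr rfl fun i _ => ?_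
    simp [ite_and, mul_comm, Finset.sum_ite_irrel]
  simp_rw [h, mean_sum]
  refine Finset.sum_congr rfl fun x _ => Finset.sum_congr rfl fun y _ => ?_
  rw [mean_mul_left, averageLaw, mul_comm]

theorem sum_averageLaw_right (PX : PMF X) (c : Code X Y n R R₀) (hn : 0 < n) (x : X) :
    ∑ y, averageLaw PX c x y = (PX x).toReal := by
  classical
  have hn' : (n : ℝ) ≠ 0 := by exact_mod_cast hn.ne'
  have h := sum_averageLaw_mul PX c fun x' _ => if x' = x then 1 else 0
  simp only [mul_ite, mul_one, mul_zero, Finset.sum_ite_irrel, Finset.sum_const_zero,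
    Finset.sum_ite_eq', Finset.mem_univ, if_true] at h
  rw [h, mean_codeLaw]
  have hc : ∀ f : (Fin n → X) → ℝ, (mean (productPMF fun _ : Fin n => PX) fun x =>
      mean c.keyLaw fun k => mean (c.encoder x k) fun m => mean (c.decoder m k) fun _ => f x)
      = mean (productPMF fun _ : Fin n => PX) f := fun f => by simp_rw [mean_const]
  rw [hc fun a => (n : ℝ)⁻¹ * ∑ i, if a i = x then 1 else 0, mean_mul_left, mean_sum]
  have e : ∀ i : Fin n, mean (productPMF fun _ : Fin n => PX) (fun f => if f i = x then 1 else 0)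
      = (PX x).toReal := fun i => by
    rw [mean_productPMF_mul _ i fun a => if a = x then 1 else 0, ← apply_toReal_eq_mean]
  simp only [e, Finset.sum_const, Finset.card_univ, Fintype.card_fin, nsmul_eq_mul]
  field_simp

theorem averageLaw_pos (PX : PMF X) (c : Code X Y n R R₀)
    {t : (Fin n → X) × (Fin n → Y) × Fin (indexSize n R)} (ht : codeLaw PX c t ≠ 0) (i : Fin n) :
    0 < averageLaw PX c (t.1 i) (t.2.1 i) := by
  classical
  have hn : 0 < n := i.pos
  rw [averageLaw, mean]
  have hnn : ∀ (t' : (Fin n → X) × (Fin n → Y) × Fin (indexSize n R)) (j : Fin n),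
      (0 : ℝ) ≤ if t'.1 j = t.1 i ∧ t'.2.1 j = t.2.1 i then 1 else 0 := by
    intro t' j
    split_ifs <;> norm_num
  refine Finset.sum_pos' (fun t' _ => mul_nonneg ENNReal.toReal_nonneg
    (mul_nonneg (by positivity) (Finset.sum_nonneg fun j _ => hnn t' j))) ⟨t, Finset.mem_univ _, ?_⟩
  refine mul_pos (ENNReal.toReal_pos ht (PMF.apply_ne_top _ _)) (mul_pos (by positivity) ?_)
  exact Finset.sum_pos' (fun j _ => hnn t j) ⟨i, Finset.mem_univ _, by simp⟩

/-- An encoder outputs a probability distribution on messages, so the message set cannot be empty.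
-/
theorem indexSize_pos {X Y : Type*} (PX : PMF X) (c : Code X Y n R R₀) : 0 < indexSize n R := by
  obtain ⟨x, -⟩ := (productPMF fun _ : Fin n => PX).support_nonempty
  obtain ⟨m, -⟩ := (c.encoder x ⟨0, c.key_pos⟩).support_nonempty
  exact m.pos

/-- Jensen's inequality for the change of measure: the product of the densities `r` has expectation
at most the number of messages. -/
theorem mean_codeLaw_sum_log_le (PX : PMF X) (c : Code X Y n R R₀) {r : X → Y → ℝ}
    (hr0 : ∀ x y, 0 ≤ r x y) (hr1 : ∀ y, ∑ x, (PX x).toReal * r x y ≤ 1)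
    (hpos : ∀ t, codeLaw PX c t ≠ 0 → ∀ i, 0 < r (t.1 i) (t.2.1 i)) :
    mean (codeLaw PX c) (fun t => ∑ i, Real.log (r (t.1 i) (t.2.1 i)))
      ≤ Real.log (indexSize n R) := by
  have hM' : (0 : ℝ) < indexSize n R := by exact_mod_cast indexSize_pos PX c
  have h1 : mean (codeLaw PX c) (fun t => ∏ i, r (t.1 i) (t.2.1 i)) ≤ indexSize n R := by
    refine mean_codeLaw_le PX c (f := fun x y => ∏ i, r (x i) (y i))
      (fun x y => Finset.prod_nonneg fun i _ => hr0 _ _) fun y => ?_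
    have : mean (productPMF fun _ : Fin n => PX) (fun x => ∏ i, r (x i) (y i))
        = ∏ i, ∑ x, (PX x).toReal * r x (y i) := by
      rw [← sum_prod_weight fun i x => (PX x).toReal * r x (y i), mean]
      refine Finset.sum_congr rfl fun x _ => ?_
      rw [Finset.prod_mul_distrib, toReal_productPMF]
    rw [this]
    exact Finset.prod_le_one (fun i _ => Finset.sum_nonneg fun x _ =>
      mul_nonneg ENNReal.toReal_nonneg (hr0 _ _)) fun i _ => hr1 _
  -- This is `log u ≤ u - 1` at `u = (∏ r) / M`, where the mean of `u` is at most one.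
  calc _ ≤ mean (codeLaw PX c) fun t => ((indexSize n R : ℝ)⁻¹ * ∏ i, r (t.1 i) (t.2.1 i))
          + (Real.log (indexSize n R) - 1) := by
        refine mean_mono _ fun t ht => ?_
        have hprod : 0 < ∏ i, r (t.1 i) (t.2.1 i) := Finset.prod_pos fun i _ => hpos t ht i
        rw [← Real.log_prod fun i _ => (hpos t ht i).ne']
        have := Real.log_le_sub_one_of_pos (mul_pos (inv_pos.2 hM') hprod)
        rw [Real.log_mul (inv_ne_zero hM'.ne') hprod.ne', Real.log_inv] at this
        linarith
    _ ≤ Real.log (indexSize n R) := by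
        rw [mean_add, mean_mul_left, mean_const]
        have : (indexSize n R : ℝ)⁻¹ * mean (codeLaw PX c) (fun t => ∏ i, r (t.1 i) (t.2.1 i))
            ≤ 1 := by
          rw [inv_mul_le_iff₀ hM', mul_one]; exact h1
        linarith

/-- The density ratio of `p` against the product of its marginals has mean at most one when only `X`
is averaged, and the expected sum of its logarithms is exactly `n · info p · log 2`. -/
theorem info_averageLaw_le (PX : PMF X) (c : Code X Y n R R₀) (hn : 0 < n) :
    info (averageLaw PX c) ≤ R := by
  have hp0 := averageLaw_nonneg PX c
  have hsum := sum_averageLaw_right PX c hn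
  have havg := sum_averageLaw_mul PX c
  have htpos := fun t => averageLaw_pos PX c (t := t)
  generalize averageLaw PX c = p at hp0 hsum havg htpos
  have hn' : (0 : ℝ) < n := by exact_mod_cast hn
  have hl : 0 < Real.log 2 := Real.log_pos (by norm_num)
  have ha0 : ∀ x, 0 ≤ ∑ y', p x y' := fun x => Finset.sum_nonneg fun _ _ => hp0 _ _
  have hq0 : ∀ y, 0 ≤ ∑ x', p x' y := fun y => Finset.sum_nonneg fun _ _ => hp0 _ _
  have h2 := mean_codeLaw_sum_log_le PX c
    (r := fun x y => p x y / ((∑ y', p x y') * ∑ x', p x' y))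
    (fun x y => div_nonneg (hp0 x y) (mul_nonneg (ha0 x) (hq0 y))) (fun y => ?_)
    (fun t ht i => ?_)
  · have h3 : Real.log (indexSize n R) ≤ n * R * Real.log 2 := by
      rw [← Real.log_rpow (by norm_num)]
      exact Real.log_le_log (by exact_mod_cast indexSize_pos PX c) (Nat.floor_le (by positivity))
    have h4 := havg fun x y => Real.log (p x y / ((∑ y', p x y') * ∑ x', p x' y))
    rw [mean_mul_left] at h4
    simp only [info, Real.logb, ← mul_div_assoc, ← Finset.sum_div]
    rw [h4, div_le_iff₀ hl, inv_mul_le_iff₀ hn']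
    linarith
  · calc ∑ x, (PX x).toReal * (p x y / ((∑ y', p x y') * ∑ x', p x' y))
        ≤ ∑ x, p x y / ∑ x', p x' y := by
          refine Finset.sum_le_sum fun x _ => ?_
          rw [← hsum x]
          by_cases h : ∑ y', p x y' = 0
          · rw [h, zero_mul]
            exact div_nonneg (hp0 x y) (hq0 y)
          · rw [← div_div, mul_div_assoc', mul_div_cancel₀ _ h]
      _ ≤ 1 := by rw [← Finset.sum_div]; exact div_self_le_one _
  · have h0 := htpos t ht i
    exact div_pos h0 (mul_pos
      (h0.trans_le (Finset.single_le_sum (f := fun y' => p (t.1 i) y') (fun _ _ => hp0 _ _)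
        (Finset.mem_univ (t.2.1 i))))
      (h0.trans_le (Finset.single_le_sum (f := fun x' => p x' (t.2.1 i)) (fun _ _ => hp0 _ _)
        (Finset.mem_univ (t.1 i)))))

end Converse

/-! ### Compactness and closedness of the relaxed region -/

section Closed

variable {X Y Z T : Type*} [Fintype X] [Fintype Y] [Fintype Z]

/-- The matrices of joint probabilities with a given first marginal `a`. -/
def couplings (a : X → ℝ) : Set (X → Y → ℝ) :=
  {p | (∀ x y, 0 ≤ p x y) ∧ ∀ x, ∑ y, p x y = a x}

theorem isCompact_couplings {X : Type*} (a : X → ℝ) :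
    IsCompact (couplings a : Set (X → Y → ℝ)) := by
  have hK : IsCompact (Set.univ.pi fun x => Set.univ.pi fun _ => Set.Icc 0 (a x) :
      Set (X → Y → ℝ)) :=
    isCompact_univ_pi fun x => isCompact_univ_pi fun _ => isCompact_Icc
  refine hK.of_isClosed_subset ?_ ?_
  · have : (couplings a : Set (X → Y → ℝ))
        = (⋂ x, ⋂ y, {p | 0 ≤ p x y}) ∩ ⋂ x, {p | ∑ y, p x y = a x} := by
      ext p
      simp [couplings]
    rw [this]
    exact (isClosed_iInter fun x => isClosed_iInter fun y =>
      isClosed_le continuous_const (by fun_prop)).inter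
      (isClosed_iInter fun x => isClosed_eq (by fun_prop) continuous_const)
  · rintro p ⟨h0, h1⟩ x - y -
    exact ⟨h0 x y, h1 x ▸ Finset.single_le_sum (f := fun y => p x y) (fun _ _ => h0 _ _)
      (Finset.mem_univ y)⟩

/-- The conditions of the single-letter region for the joint law `p` and the channels `κ z`, where
triples of payoff `-∞` are allowed to have probability at most `t.1`. -/
def Feasible (κ : T → X → Y → Z → ℝ) (π : X → Y → Z → EReal) (p : X → Y → ℝ)
    (t : ℝ × ℝ × ℝ × ℝ) : Prop :=
  info p ≤ t.2.1 ∧ 0 ≤ t.2.2.1 ∧ ∀ z, (∀ x y w, π x y w = ⊥ → p x y * κ z x y w ≤ t.1) ∧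
    t.2.2.2 ≤ ∑ x, ∑ y, p x y * ∑ w, κ z x y w * (π x y w).toReal

/-- The relaxed single-letter region, with the tolerance as first coordinate. -/
def relaxedRegion (a : X → ℝ) (κ : T → X → Y → Z → ℝ) (π : X → Y → Z → EReal) :
    Set (ℝ × ℝ × ℝ × ℝ) :=
  {t | ∃ p ∈ (couplings a : Set (X → Y → ℝ)), Feasible κ π p t}

/-- The feasibility conditions are closed jointly in `p` and `t`, and projecting out the compact
factor of couplings is a closed map. -/
theorem isClosed_relaxedRegion (a : X → ℝ) (κ : T → X → Y → Z → ℝ) (π : X → Y → Z → EReal) :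
    IsClosed (relaxedRegion a κ π) := by
  have : CompactSpace ↥(couplings a : Set (X → Y → ℝ)) :=
    isCompact_iff_compactSpace.1 (isCompact_couplings a)
  have hinfo : Continuous fun p : ↥(couplings a : Set (X → Y → ℝ)) => info p.1 :=
    continuousOn_info.comp_continuous continuous_subtype_val fun p => p.2.1
  have : IsClosed {u : ↥(couplings a : Set (X → Y → ℝ)) × (ℝ × ℝ × ℝ × ℝ) |
      Feasible κ π u.1.1 u.2} := by
    simp only [Feasible, Set.ofPred_forall, Set.ofPred_and]
    have hc : ∀ x y, Continuous fun u : ↥(couplings a : Set (X → Y → ℝ)) × (ℝ × ℝ × ℝ × ℝ) =>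
        u.1.1 x y := fun x y =>
      (continuous_apply_apply x y).comp (continuous_subtype_val.comp continuous_fst)
    refine IsClosed.inter ?_ (IsClosed.inter ?_ (isClosed_iInter fun z => IsClosed.inter ?_ ?_))
    · exact isClosed_le (hinfo.comp continuous_fst) (by fun_prop)
    · exact isClosed_le continuous_const (by fun_prop)
    · exact isClosed_iInter fun x => isClosed_iInter fun y => isClosed_iInter fun w =>
        isClosed_iInter fun _ => isClosed_le ((hc x y).mul_const _) (by fun_prop)
    · exact isClosed_le (by fun_prop) (continuous_finsetSum _ fun x _ =>
        continuous_finsetSum _ fun y _ => (hc x y).mul_const _)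
  have h2 := isClosedMap_snd_of_compactSpace _ this
  convert h2 using 1
  ext t
  simp [relaxedRegion]

end Closed

/-! ### The single-letter region as a slice of the relaxed region -/

section Region

variable {X Y Z Wx Wy : Type*} [Fintype X] [Fintype Y] [Fintype Z]

/-- The transition probabilities from `(X, Y)` to `z(W_x, W_y)`. -/
def pureKernel (PWx : X → PMF Wx) (PWy : Y → PMF Wy) (z : Wx × Wy → Z) (x : X) (y : Y) (w : Z) :
    ℝ :=
  (effectiveChannel PWx PWy (fun v => PMF.pure (z v)) x y w).toReal

theorem mean_singleLetterLaw (PX : PMF X) (PWx : X → PMF Wx) (PWy : Y → PMF Wy) (PY : X → PMF Y)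
    (z : Wx × Wy → Z) (f : X × Y × Z → ℝ) :
    mean (singleLetterLaw PX PWx PWy PY z) f = ∑ x, ∑ y, (jointLaw PX PY (x, y)).toReal *
      ∑ w, pureKernel PWx PWy z x y w * f (x, y, w) := by
  rw [singleLetterLaw_eq, mean_bind, mean, Fintype.sum_prod_type]
  simp only [mean_map]
  rfl

theorem toReal_singleLetterLaw (PX : PMF X) (PWx : X → PMF Wx) (PWy : Y → PMF Wy)
    (PY : X → PMF Y) (z : Wx × Wy → Z) (x : X) (y : Y) (w : Z) :
    (singleLetterLaw PX PWx PWy PY z (x, y, w)).toReal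
      = (jointLaw PX PY (x, y)).toReal * pureKernel PWx PWy z x y w := by
  classical
  rw [apply_toReal_eq_mean, mean_singleLetterLaw]
  simp [ite_and, Finset.sum_ite_irrel]

theorem exists_channel (PX : PMF X) {p : X → Y → ℝ} (hp : p ∈ couplings fun x => (PX x).toReal) :
    ∃ PY : X → PMF Y, ∀ x y, (jointLaw PX PY (x, y)).toReal = p x y := by
  obtain ⟨h0, h1⟩ := hp
  have hY : Nonempty Y := by
    by_contra h
    rw [not_nonempty_iff] at h
    have := sum_toReal_eq_one PX
    simp [← h1] at this
  have key : ∀ x, ∃ q : PMF Y, ∀ y, (PX x).toReal * (q y).toReal = p x y := by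
    intro x
    by_cases hx : (PX x).toReal = 0
    -- An input of probability zero may be given any output law.
    · refine ⟨PMF.pure hY.some, fun y => ?_⟩
      have h := h1 x
      simp only [hx] at h ⊢
      rw [Finset.sum_eq_zero_iff_of_nonneg fun _ _ => h0 _ _] at h
      rw [zero_mul, h y (Finset.mem_univ y)]
    · obtain ⟨q, hq⟩ := exists_pmf_toReal_eq (w := fun y => p x y / (PX x).toReal)
        (fun y => div_nonneg (h0 x y) ENNReal.toReal_nonneg)
        (by rw [← Finset.sum_div, h1, div_self hx])
      exact ⟨q, fun y => by rw [hq, mul_div_cancel₀ _ hx]⟩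
  choose PY hPY using key
  exact ⟨PY, fun x y => by rw [toReal_jointLaw, hPY]⟩

/-- Couplings with first marginal `PX` are exactly the laws `PX · P_{Y|X}`, and tolerance zero says
that `-∞` has no mass. -/
theorem mem_singleLetterRegion_iff (PX : PMF X) (PWx : X → PMF Wx) (PWy : Y → PMF Wy)
    {π : X → Y → Z → EReal} (hπ : ∀ x y z, π x y z ≠ ⊤) (t : ℝ × ℝ × ℝ) :
    t ∈ singleLetterRegion PX PWx PWy π ↔
      (0, t) ∈ relaxedRegion (fun x => (PX x).toReal) (pureKernel PWx PWy) π := by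
  have key : ∀ PY : X → PMF Y, (mutualInfo (jointLaw PX PY) ≤ t.1 ∧ 0 ≤ t.2.1 ∧
      (t.2.2 : EReal) ≤ ⨅ z : Wx × Wy → Z,
        expect (singleLetterLaw PX PWx PWy PY z) fun ω => π ω.1 ω.2.1 ω.2.2) ↔
      Feasible (pureKernel PWx PWy) π (fun x y => (jointLaw PX PY (x, y)).toReal) (0, t) := by
    intro PY
    simp only [Feasible, mutualInfo_eq_info, le_iInf_iff]
    refine and_congr_right fun _ => and_congr_right fun _ => forall_congr' fun z => ?_
    rw [coe_le_expect_iff _ (fun ω => hπ _ _ _), mean_singleLetterLaw]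
    refine and_congr_left fun _ => ?_
    simp only [Prod.forall]
    refine forall_congr' fun x => forall_congr' fun y => forall_congr' fun w =>
      imp_congr_right fun _ => ?_
    rw [← toReal_singleLetterLaw]
    refine ⟨fun h => by simp [h], fun h => ?_⟩
    have := le_antisymm h ENNReal.toReal_nonneg
    exact ((ENNReal.toReal_eq_zero_iff _).1 this).resolve_right (PMF.apply_ne_top _ _)
  rw [singleLetterRegion, Set.mem_iUnion]
  constructor
  · rintro ⟨PY, h⟩
    refine ⟨_, ⟨fun x y => ENNReal.toReal_nonneg, fun x => ?_⟩, (key PY).1 h⟩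
    simp only [toReal_jointLaw, sum_toReal_jointLaw]
  · rintro ⟨p, hp, h⟩
    obtain ⟨PY, hPY⟩ := exists_channel PX hp
    refine ⟨PY, (key PY).2 ?_⟩
    simpa only [hPY] using h

theorem isClosed_singleLetterRegion (PX : PMF X) (PWx : X → PMF Wx) (PWy : Y → PMF Wy)
    {π : X → Y → Z → EReal} (hπ : ∀ x y z, π x y z ≠ ⊤) :
    IsClosed (singleLetterRegion PX PWx PWy π) := by
  have : singleLetterRegion PX PWx PWy π = (fun t : ℝ × ℝ × ℝ => ((0 : ℝ), t)) ⁻¹'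
      relaxedRegion (fun x => (PX x).toReal) (pureKernel PWx PWy) π :=
    Set.ext (mem_singleLetterRegion_iff PX PWx PWy hπ)
  rw [this]
  exact (isClosed_relaxedRegion _ _ _).preimage (by fun_prop)

end Region

/-! ### Converse for the average and the assured criterion -/

section Converse

variable {X Y Z Wx Wy : Type*} [Fintype X] [Fintype Y] [Fintype Z] {R R₀ : ℝ}

theorem averageLaw_mem_couplings {n : ℕ} (PX : PMF X) (c : Code X Y n R R₀) (hn : 0 < n) :
    averageLaw PX c ∈ couplings fun x => (PX x).toReal :=
  ⟨averageLaw_nonneg PX c, sum_averageLaw_right PX c hn⟩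

/-- Against a fixed map `z` that ignores message and time, the payoff depends on the code only
through its time-averaged law. -/
theorem average_mean_symbolLaw {n : ℕ} (PX : PMF X) (PWx : X → PMF Wx) (PWy : Y → PMF Wy)
    (c : Code X Y n R R₀) (z : Wx × Wy → Z) (f : X → Y → Z → ℝ) :
    (n : ℝ)⁻¹ * ∑ i, mean (symbolLaw PX PWx PWy c i fun _ w => PMF.pure (z w))
        (fun ω => f ω.1 ω.2.1 ω.2.2)
      = ∑ x, ∑ y, averageLaw PX c x y * ∑ w, pureKernel PWx PWy z x y w * f x y w := by
  rw [sum_averageLaw_mul, mean_mul_left, mean_sum]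
  simp only [mean_symbolLaw]
  rfl

/-- At block length one, a nonempty key set means `2^R₀ ≥ 1`. -/
theorem nonneg_of_code {X Y : Type*} (c : Code X Y 1 R R₀) : 0 ≤ R₀ := by
  have h := Nat.one_le_iff_ne_zero.2 c.key_pos.ne'
  rw [indexSize, Nat.one_le_floor_iff] at h
  by_contra! hneg
  have := Real.rpow_lt_one_of_one_lt_of_neg one_lt_two hneg
  simp at h
  linarith

theorem AchievableAvg.mem_singleLetterRegion {PX : PMF X} {PWx : X → PMF Wx} {PWy : Y → PMF Wy}
    {π : X → Y → Z → EReal} (htop : ∀ x y z, π x y z ≠ ⊤) (hbot : ∀ x y z, π x y z ≠ ⊥)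
    {P : ℝ} (h : AchievableAvg PX PWx PWy π R R₀ P) :
    (R, R₀, P) ∈ singleLetterRegion PX PWx PWy π := by
  obtain ⟨c, hc⟩ := h
  rw [mem_singleLetterRegion_iff PX PWx PWy htop]
  -- The liminf bound yields only values strictly below `P`, so each `k` contributes one block
  -- length with payoff at least `P - 1/(k+1)`.
  have hlim : Tendsto (fun k : ℕ => ((0 : ℝ), R, R₀, P - 1 / ((k : ℝ) + 1))) atTop
      (𝓝 (0, R, R₀, P)) := by
    have := (tendsto_const_nhds (x := P)).sub (tendsto_one_div_add_atTop_nhds_zero_nat (𝕜 := ℝ))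
    rw [sub_zero] at this
    exact tendsto_const_nhds.prodMk_nhds (tendsto_const_nhds.prodMk_nhds
      (tendsto_const_nhds.prodMk_nhds this))
  refine (isClosed_relaxedRegion _ _ _).mem_of_tendsto hlim (Eventually.of_forall fun k => ?_)
  have hlt : ((P - 1 / ((k : ℝ) + 1) : ℝ) : EReal) < P := by
    rw [EReal.coe_lt_coe_iff]
    have : 0 < 1 / ((k : ℝ) + 1) := by positivity
    linarith
  obtain ⟨n, hn, hn0⟩ := ((eventually_lt_of_lt_liminf (hlt.trans_le hc)).and
    (eventually_gt_atTop 0)).exists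
  refine ⟨averageLaw PX (c n), averageLaw_mem_couplings PX (c n) hn0,
    info_averageLaw_le PX (c n) hn0, nonneg_of_code (c 1), fun z => ⟨fun x y w hw =>
    absurd hw (hbot x y w), ?_⟩⟩
  have := hn.le.trans (iInf_le _ fun _ _ w => PMF.pure (z w))
  rw [coe_le_expect_blockLaw_iff htop hbot,
    average_mean_symbolLaw PX PWx PWy (c n) z fun x y w => (π x y w).toReal] at this
  exact this

theorem exists_abs_le (f : X → Y → Z → ℝ) : ∃ B, 0 ≤ B ∧ ∀ x y z, |f x y z| ≤ B := by
  refine ⟨∑ x, ∑ y, ∑ z, |f x y z|, by positivity, fun x y z => ?_⟩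
  calc |f x y z| ≤ ∑ z, |f x y z| :=
        Finset.single_le_sum (f := fun z => |f x y z|) (fun _ _ => abs_nonneg _) (Finset.mem_univ z)
    _ ≤ ∑ y, ∑ z, |f x y z| := Finset.single_le_sum (f := fun y => ∑ z, |f x y z|)
        (fun _ _ => by positivity) (Finset.mem_univ y)
    _ ≤ _ := Finset.single_le_sum (f := fun x => ∑ y, ∑ z, |f x y z|)
        (fun _ _ => by positivity) (Finset.mem_univ x)

theorem neg_le_average {n : ℕ} (hn : 0 < n) {B : ℝ} {f : Fin n → ℝ} (hf : ∀ i, -B ≤ f i) :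
    -B ≤ (n : ℝ)⁻¹ * ∑ i, f i := by
  have hn' : (0 : ℝ) < n := by exact_mod_cast hn
  rw [le_inv_mul_iff₀ hn']
  calc (n : ℝ) * -B = ∑ _i : Fin n, -B := by simp
    _ ≤ _ := Finset.sum_le_sum fun i _ => hf i

/-- On the good event, of probability at least `v`, no coordinate has payoff `-∞` and the average is
at least `P`. Elsewhere the truncated payoff is at least `-B`, whence the mean is at least `v P - (1
- v) B`. -/
theorem feasible_of_assured {n : ℕ} (hn : 0 < n) {PX : PMF X} {PWx : X → PMF Wx}
    {PWy : Y → PMF Wy} {π : X → Y → Z → EReal} (hπ : ∀ x y z, π x y z ≠ ⊤) (c : Code X Y n R R₀)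
    (hR₀ : 0 ≤ R₀) {P B v : ℝ} (hPB : 0 ≤ P + B) (hB : ∀ x y z, |(π x y z).toReal| ≤ B)
    (hv : ∀ s : Fin n → Fin (indexSize n R) → Wx × Wy → PMF Z, v ≤
      ((blockLaw PX PWx PWy c s).toOuterMeasure {ω | (P : EReal) ≤ blockPayoff π ω}).toReal) :
    Feasible (pureKernel PWx PWy) π (averageLaw PX c) (1 - v, R, R₀, v * (P + B) - B) := by
  classical
  refine ⟨info_averageLaw_le PX c hn, hR₀, fun z => ?_⟩
  have hz := hv fun _ _ w => PMF.pure (z w)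
  rw [toOuterMeasure_toReal] at hz
  set q := blockLaw PX PWx PWy c fun _ _ w => PMF.pure (z w) with hq
  have hblock := fun f => (mean_blockLaw_average PX PWx PWy c (fun _ _ w => PMF.pure (z w)) f).trans
    (average_mean_symbolLaw PX PWx PWy c z f)
  have hgood : ∀ ω : (Fin n → X) × (Fin n → Y) × (Fin n → Z), (P : EReal) ≤ blockPayoff π ω ↔ _ :=
    fun ω => coe_le_inv_mul_sum_iff hn (f := fun i => π (ω.1 i) (ω.2.1 i) (ω.2.2 i))
      (fun i => hπ _ _ _) P
  have hn' : (0 : ℝ) < n := by exact_mod_cast hn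
  constructor
  · intro x y w hw
    have h1 := hblock fun x' y' w' => if x' = x ∧ y' = y ∧ w' = w then 1 else 0
    have h2 : ∑ x', ∑ y', averageLaw PX c x' y' * ∑ w', pureKernel PWx PWy z x' y' w' *
        (if x' = x ∧ y' = y ∧ w' = w then 1 else 0)
        = averageLaw PX c x y * pureKernel PWx PWy z x y w := by
      simp [ite_and, Finset.sum_ite_irrel]
    rw [h2] at h1
    rw [← h1]
    -- The fraction of coordinates showing the forbidden triple is zero on the good event and at
    -- most one otherwise.
    calc _ ≤ mean q fun ω => 1 + (-1) *
            (if ω ∈ {ω | (P : EReal) ≤ blockPayoff π ω} then 1 else 0) := by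
          refine mean_mono _ fun ω _ => ?_
          rw [inv_mul_le_iff₀ hn']
          split_ifs with h
          · have h' := ((hgood ω).1 h).1
            refine (Finset.sum_eq_zero fun i _ => if_neg ?_).le.trans (by simp)
            rintro ⟨rfl, rfl, rfl⟩
            exact h' i hw
          · calc _ ≤ ∑ _i : Fin n, (1 : ℝ) :=
                  Finset.sum_le_sum fun i _ => by split_ifs <;> norm_num
              _ = _ := by simp
      _ ≤ 1 - v := by
          rw [mean_add, mean_const, mean_mul_left]
          linarith
  · rw [← hblock fun x y w => (π x y w).toReal]
    calc v * (P + B) - B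
        ≤ mean q fun ω => (P + B) * (if ω ∈ {ω | (P : EReal) ≤ blockPayoff π ω} then 1 else 0)
            + -B := by
          rw [mean_add, mean_const, mean_mul_left]
          nlinarith
      _ ≤ _ := by
          refine mean_mono _ fun ω _ => ?_
          split_ifs with h
          · have h' := ((hgood ω).1 h).2
            linarith
          · rw [mul_zero, zero_add]
            exact neg_le_average hn fun i => (abs_le.1 (hB _ _ _)).1

theorem AchievableWhp.mem_singleLetterRegion {PX : PMF X} {PWx : X → PMF Wx} {PWy : Y → PMF Wy}
    {π : X → Y → Z → EReal} (hπ : ∀ x y z, π x y z ≠ ⊤) {P : ℝ}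
    (h : AchievableWhp PX PWx PWy π R R₀ P) :
    (R, R₀, P) ∈ singleLetterRegion PX PWx PWy π := by
  obtain ⟨c, hc⟩ := h
  rw [mem_singleLetterRegion_iff PX PWx PWy hπ]
  obtain ⟨B₀, hB₀, hB⟩ := exists_abs_le fun x y z => (π x y z).toReal
  -- Adding `|P|` makes `P + B` nonnegative, so a lower bound on the probability can be multiplied
  -- by it.
  set B := B₀ + |P| with hBdef
  set v : ℕ → ℝ≥0∞ := fun n => ⨅ s : Fin n → Fin (indexSize n R) → Wx × Wy → PMF Z,
    (blockLaw PX PWx PWy (c n) s).toOuterMeasure {ω | (P : EReal) ≤ blockPayoff π ω} with hv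
  have hv1 : Tendsto (fun n => (v n).toReal) atTop (𝓝 1) :=
    (ENNReal.tendsto_toReal ENNReal.one_ne_top).comp hc
  have hlim : Tendsto (fun n => (1 - (v n).toReal, R, R₀, (v n).toReal * (P + B) - B)) atTop
      (𝓝 (0, R, R₀, P)) := by
    have h1 := (tendsto_const_nhds (x := (1 : ℝ))).sub hv1
    have h2 := (hv1.mul_const (P + B)).sub_const B
    rw [sub_self] at h1
    rw [one_mul, add_sub_cancel_right] at h2
    exact h1.prodMk_nhds (tendsto_const_nhds.prodMk_nhds (tendsto_const_nhds.prodMk_nhds h2))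
  refine (isClosed_relaxedRegion _ _ _).mem_of_tendsto hlim ?_
  filter_upwards [eventually_gt_atTop 0] with n hn
  refine ⟨_, averageLaw_mem_couplings PX (c n) hn, feasible_of_assured hn hπ (c n)
    (nonneg_of_code (c 1)) ?_ (fun x y z => (hB x y z).trans ?_) fun s => ?_⟩
  · linarith [neg_abs_le P]
  · linarith [abs_nonneg P]
  · exact ENNReal.toReal_mono (ne_top_of_le_ne_top ENNReal.one_ne_top (toOuterMeasure_le_one _ _))
      (iInf_le _ s)

end Converse

/-! ### Soft covering by a random codebook -/

section SoftCovering

variable {A B ι κ : Type*} [Fintype A] [Fintype B] [Fintype ι] [DecidableEq ι] [Fintype κ]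
  [Nonempty κ]

theorem sum_prod_weight_mul_abs_average_comp_sub_le {w : B → ℝ} (hw : ∀ b, 0 ≤ w b)
    (hw1 : ∑ b, w b = 1) (e : κ ↪ ι) (g : B → ℝ) :
    ∑ f : ι → B, (∏ l, w (f l)) *
        |(Fintype.card κ : ℝ)⁻¹ * ∑ k, g (f (e k)) - ∑ b, w b * g b|
      ≤ √((∑ b, w b * g b ^ 2) / Fintype.card κ) := by
  have := sum_prod_weight_mul_abs_average_sub_le hw hw1 (Finset.univ.map e)
    (Finset.univ_nonempty.map) g
  simpa only [Finset.card_map, Finset.card_univ, Finset.sum_map] using this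

/-- The soft-covering bound: the output distribution `P` of a channel `W` with input distribution
`w` is approximated in expectation by the output distribution of a random codebook. -/
theorem soft_covering {w : B → ℝ} (hw : ∀ b, 0 ≤ w b) (hw1 : ∑ b, w b = 1) (e : κ ↪ ι)
    {W : B → A → ℝ} (hW : ∀ b a, 0 ≤ W b a) (hW1 : ∀ b, ∑ a, W b a = 1) {P : A → ℝ}
    (hP : ∀ a, ∑ b, w b * W b a = P a) {D : ℝ} (hD : 0 ≤ D) :
    ∑ f : ι → B, (∏ l, w (f l)) *
        ∑ a, |P a - (Fintype.card κ : ℝ)⁻¹ * ∑ k, W (f (e k)) a|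
      ≤ √(D / Fintype.card κ) + 2 * ∑ b, ∑ a, w b * if W b a ≤ D * P a then 0 else W b a := by
  set N : ℝ := (Fintype.card κ : ℝ) with hN
  have hN0 : 0 < N := by rw [hN]; exact_mod_cast Fintype.card_pos
  -- The channel is truncated at `D * P a`: the bounded part `g` is controlled by its second moment,
  -- the rest `h` by twice its mean.
  set g : A → B → ℝ := fun a b => if W b a ≤ D * P a then W b a else 0 with hg
  set h : A → B → ℝ := fun a b => if W b a ≤ D * P a then 0 else W b a with hh
  have hgh : ∀ a b, W b a = g a b + h a b := fun a b => by simp only [hg, hh]; split_ifs <;> simp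
  have hh0 : ∀ a b, 0 ≤ h a b := fun a b => by
    simp only [hh]; split_ifs; exacts [le_rfl, hW b a]
  have hP0 : ∀ a, 0 ≤ P a := fun a => hP a ▸ Finset.sum_nonneg fun b _ => mul_nonneg (hw b) (hW b a)
  have hP1 : ∑ a, P a = 1 := by
    simp only [← hP]
    rw [Finset.sum_comm]
    simp only [← Finset.mul_sum, hW1, mul_one, hw1]
  have hprod0 : ∀ f : ι → B, 0 ≤ ∏ l, w (f l) := fun f => Finset.prod_nonneg fun l _ => hw _
  have hEh : ∀ a, ∑ f : ι → B, (∏ l, w (f l)) * (N⁻¹ * ∑ k, h a (f (e k))) = ∑ b, w b * h a b := by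
    intro a
    have : ∀ f : ι → B, (∏ l, w (f l)) * (N⁻¹ * ∑ k, h a (f (e k)))
        = N⁻¹ * ∑ k, (∏ l, w (f l)) * h a (f (e k)) := fun f => by
      rw [← Finset.mul_sum]; ring
    simp only [this]
    rw [← Finset.mul_sum, Finset.sum_comm]
    simp only [sum_prod_weight_mul (p := fun _ : ι => w) (fun _ => hw1) _ (h a)]
    rw [Finset.sum_const, Finset.card_univ, nsmul_eq_mul, ← hN, inv_mul_cancel_left₀ hN0.ne']
  have hone : ∑ f : ι → B, ∏ l, w (f l) = 1 :=
    sum_prod_weight_eq_one (p := fun _ : ι => w) fun _ => hw1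
  have hpt : ∀ a, ∑ f : ι → B, (∏ l, w (f l)) * |P a - N⁻¹ * ∑ k, W (f (e k)) a|
      ≤ P a * √(D / N) + 2 * ∑ b, w b * h a b := by
    intro a
    have hsplit : P a = ∑ b, w b * g a b + ∑ b, w b * h a b := by
      rw [← hP, ← Finset.sum_add_distrib]
      exact Finset.sum_congr rfl fun b _ => by rw [hgh, mul_add]
    calc _ ≤ ∑ f : ι → B, ((∏ l, w (f l)) * |N⁻¹ * ∑ k, g a (f (e k)) - ∑ b, w b * g a b|
            + (∏ l, w (f l)) * (∑ b, w b * h a b)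
            + (∏ l, w (f l)) * (N⁻¹ * ∑ k, h a (f (e k)))) := by
          refine Finset.sum_le_sum fun f _ => ?_
          rw [← mul_add, ← mul_add]
          refine mul_le_mul_of_nonneg_left ?_ (hprod0 f)
          have h1 : N⁻¹ * ∑ k, W (f (e k)) a
              = N⁻¹ * ∑ k, g a (f (e k)) + N⁻¹ * ∑ k, h a (f (e k)) := by
            rw [← mul_add, ← Finset.sum_add_distrib]
            simp only [hgh]
          have h2 : 0 ≤ N⁻¹ * ∑ k, h a (f (e k)) :=
            mul_nonneg (inv_nonneg.2 hN0.le) (Finset.sum_nonneg fun k _ => hh0 _ _)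
          have h3 : 0 ≤ ∑ b, w b * h a b :=
            Finset.sum_nonneg fun b _ => mul_nonneg (hw b) (hh0 _ _)
          rw [h1, hsplit, abs_le]
          have h4 := abs_le.1 (le_refl |N⁻¹ * ∑ k, g a (f (e k)) - ∑ b, w b * g a b|)
          constructor <;> linarith [h4.1, h4.2]
      _ = (∑ f : ι → B, (∏ l, w (f l)) * |N⁻¹ * ∑ k, g a (f (e k)) - ∑ b, w b * g a b|)
            + 2 * ∑ b, w b * h a b := by
          rw [Finset.sum_add_distrib, Finset.sum_add_distrib, hEh, ← Finset.sum_mul, hone]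
          ring
      _ ≤ _ := by
          gcongr
          refine (sum_prod_weight_mul_abs_average_comp_sub_le hw hw1 e (g a)).trans ?_
          rw [← Real.sqrt_sq (hP0 a), ← Real.sqrt_mul (sq_nonneg _)]
          refine Real.sqrt_le_sqrt ?_
          rw [← mul_div_assoc]
          refine div_le_div_of_nonneg_right ?_ hN0.le
          -- Truncation gives `g² ≤ D P(a) W`, and averaging `W` over the input returns `P(a)`.
          calc ∑ b, w b * g a b ^ 2 ≤ ∑ b, D * P a * (w b * W b a) := by
                refine Finset.sum_le_sum fun b _ => ?_
                have : g a b ^ 2 ≤ D * P a * W b a := by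
                  simp only [hg]
                  split_ifs with hc
                  · nlinarith [hW b a]
                  · have := mul_nonneg (mul_nonneg hD (hP0 a)) (hW b a)
                    simpa using this
                nlinarith [mul_le_mul_of_nonneg_left this (hw b)]
            _ = P a ^ 2 * D := by rw [← Finset.mul_sum, hP]; ring
  calc _ = ∑ a, ∑ f : ι → B, (∏ l, w (f l)) * |P a - N⁻¹ * ∑ k, W (f (e k)) a| := by
        rw [Finset.sum_comm]
        simp only [Finset.mul_sum]
    _ ≤ ∑ a, (P a * √(D / N) + 2 * ∑ b, w b * h a b) := Finset.sum_le_sum fun a _ => hpt a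
    _ = _ := by
        rw [Finset.sum_add_distrib, ← Finset.sum_mul, hP1, one_mul, ← Finset.mul_sum,
          Finset.sum_comm]

end SoftCovering

/-! ### The reverse channel and the information density -/

section ReverseChannel

variable {X Y : Type*} [Fintype X] [Fintype Y] {p : X → Y → ℝ}

/-- The second marginal. -/
def marginal {Y : Type*} (p : X → Y → ℝ) (y : Y) : ℝ := ∑ x, p x y

/-- The reverse channel `P_{X|Y}`. -/
def reverse (p : X → Y → ℝ) (y : Y) (x : X) : ℝ :=
  -- The default for a letter of mass zero must also be a probability law when `p` is one; the first
  -- marginal serves.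
  if marginal p y = 0 then ∑ y', p x y' else p x y / marginal p y

theorem marginal_nonneg {Y : Type*} {p : X → Y → ℝ} (hp : ∀ x y, 0 ≤ p x y)
    (y : Y) : 0 ≤ marginal p y :=
  Finset.sum_nonneg fun x _ => hp x y

theorem sum_marginal (hp1 : ∑ x, ∑ y, p x y = 1) : ∑ y, marginal p y = 1 := by
  rw [← hp1, Finset.sum_comm]
  rfl

theorem reverse_nonneg (hp : ∀ x y, 0 ≤ p x y) (y : Y) (x : X) : 0 ≤ reverse p y x := by
  rw [reverse]
  split_ifs
  · exact Finset.sum_nonneg fun y _ => hp x y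
  · exact div_nonneg (hp x y) (marginal_nonneg hp y)

theorem sum_reverse (hp1 : ∑ x, ∑ y, p x y = 1) (y : Y) : ∑ x, reverse p y x = 1 := by
  simp only [reverse]
  split_ifs with h
  · exact hp1
  · rw [← Finset.sum_div]
    exact div_self h

theorem marginal_mul_reverse (hp : ∀ x y, 0 ≤ p x y) (x : X) (y : Y) :
    marginal p y * reverse p y x = p x y := by
  rw [reverse]
  split_ifs with h
  · rw [h, zero_mul]
    exact (((Finset.sum_eq_zero_iff_of_nonneg fun _ _ => hp _ _).1 h) x (Finset.mem_univ x)).symm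
  · exact mul_div_cancel₀ _ h

/-- The memoryless reverse channel. -/
def blockReverse {n : ℕ} (p : X → Y → ℝ) (y : Fin n → Y) (x : Fin n → X) : ℝ :=
  ∏ i, reverse p (y i) (x i)

/-- The distribution of independent samples of the second marginal. -/
def blockMarginal {n : ℕ} (p : X → Y → ℝ) (y : Fin n → Y) : ℝ := ∏ i, marginal p (y i)

theorem sum_blockMarginal_mul {n : ℕ} (hp : ∀ x y, 0 ≤ p x y) (x : Fin n → X) :
    ∑ y, blockMarginal p y * blockReverse p y x = ∏ i, ∑ y, p (x i) y := by
  simp only [blockMarginal, blockReverse, ← Finset.prod_mul_distrib, marginal_mul_reverse hp]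
  exact sum_prod_weight fun i y => p (x i) y

theorem sum_sum_eq_sum_pair {n : ℕ} {Z : Type*} [Fintype Z] (F : (Fin n → X) → (Fin n → Z) → ℝ) :
    ∑ x, ∑ z, F x z = ∑ f : Fin n → X × Z, F (fun i => (f i).1) fun i => (f i).2 := by
  rw [← Fintype.sum_prod_type' F]
  exact ((Equiv.arrowProdEquivProdArrow (Fin n) (fun _ => X) fun _ => Z).sum_comp
    fun u : (Fin n → X) × (Fin n → Z) => F u.1 u.2).symm

/-- The weak law of large numbers for the information density. -/
theorem exists_atypical_le (hp : ∀ x y, 0 ≤ p x y) (hp1 : ∑ x, ∑ y, p x y = 1) {δ : ℝ}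
    (hδ : 0 < δ) : ∃ C, ∀ n : ℕ, 0 < n →
      ∑ y : Fin n → Y, ∑ x : Fin n → X, blockMarginal p y *
        (if blockReverse p y x ≤ Real.exp (n * (info p * Real.log 2 + δ)) * ∏ i, ∑ y', p (x i) y'
          then 0 else blockReverse p y x) ≤ C / n := by
  -- `L` is the information density in nats, with mean `I`, the mutual information converted from
  -- bits.
  set L : Y × X → ℝ := fun u => Real.log (reverse p u.1 u.2 / ∑ y', p u.2 y') with hL
  set I := info p * Real.log 2 with hI
  have hl : Real.log 2 ≠ 0 := (Real.log_pos (by norm_num)).ne'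
  have hp1' : ∑ u : Y × X, p u.2 u.1 = 1 := by
    rw [Fintype.sum_prod_type, Finset.sum_comm]
    exact hp1
  have hmean : ∑ u : Y × X, p u.2 u.1 * L u = I := by
    rw [Fintype.sum_prod_type, Finset.sum_comm, hI, info, Finset.sum_mul]
    refine Finset.sum_congr rfl fun x _ => ?_
    rw [Finset.sum_mul]
    refine Finset.sum_congr rfl fun y _ => ?_
    rw [Real.logb, mul_assoc, div_mul_cancel₀ _ hl]
    rcases (hp x y).eq_or_lt with h0 | h0
    · simp [← h0]
    · have hq : marginal p y ≠ 0 := (h0.trans_le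
        (Finset.single_le_sum (f := fun x' => p x' y) (fun _ _ => hp _ _) (Finset.mem_univ x))).ne'
      simp only [hL, reverse, if_neg hq]
      rw [div_div, mul_comm (marginal p y)]
      rfl
  refine ⟨(∑ u : Y × X, p u.2 u.1 * (L u - I) ^ 2) / δ ^ 2, fun n hn => ?_⟩
  have hn' : (0 : ℝ) < n := by exact_mod_cast hn
  rw [sum_sum_eq_sum_pair]
  have hcen := sum_prod_weight_mul_sq_of_centered (ι := Fin n) (p := fun _ (u : Y × X) => p u.2 u.1)
    (fun _ => hp1') (g := fun _ u => L u - I) fun _ => by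
      simp only [mul_sub, Finset.sum_sub_distrib, hmean, ← Finset.sum_mul, hp1', one_mul, sub_self]
  -- Chebyshev: exceeding the threshold forces the centered sum of densities above `n δ`, so the
  -- indicator is at most the squared sum over `(n δ)²`.
  calc _ ≤ ∑ f : Fin n → Y × X, ((n : ℝ) ^ 2 * δ ^ 2)⁻¹ *
          ((∏ i, p (f i).2 (f i).1) * (∑ i, (L (f i) - I)) ^ 2) := by
        refine Finset.sum_le_sum fun f _ => ?_
        have hpr : 0 ≤ ∏ i, p (f i).2 (f i).1 := Finset.prod_nonneg fun i _ => hp _ _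
        have hR : 0 ≤ ((n : ℝ) ^ 2 * δ ^ 2)⁻¹ *
            ((∏ i, p (f i).2 (f i).1) * (∑ i, (L (f i) - I)) ^ 2) := by positivity
        split_ifs with hc
        · simpa using hR
        have hprod : (blockMarginal p fun i => (f i).1) * blockReverse p (fun i => (f i).1)
            (fun i => (f i).2) = ∏ i, p (f i).2 (f i).1 := by
          simp only [blockMarginal, blockReverse, ← Finset.prod_mul_distrib,
            marginal_mul_reverse hp]
        rw [hprod]
        rcases hpr.eq_or_lt with h0 | h0
        · rw [← h0]; simp
        have hpi : ∀ i, 0 < p (f i).2 (f i).1 := fun i => (hp _ _).lt_of_ne fun h =>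
          h0.ne' (Finset.prod_eq_zero (Finset.mem_univ i) h.symm)
        have hai : ∀ i, 0 < ∑ y', p (f i).2 y' := fun i => (hpi i).trans_le
          (Finset.single_le_sum (f := fun y' => p (f i).2 y') (fun _ _ => hp _ _)
            (Finset.mem_univ _))
        have hri : ∀ i, 0 < reverse p (f i).1 (f i).2 := fun i =>
          (reverse_nonneg hp _ _).lt_of_ne fun h => (hpi i).ne' (by
            rw [← marginal_mul_reverse hp, ← h, mul_zero])
        have hsum : n * δ < ∑ i, (L (f i) - I) := by
          have h1 : Real.log (Real.exp (n * (I + δ)) * ∏ i, ∑ y', p (f i).2 y')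
              < Real.log (blockReverse p (fun i => (f i).1) fun i => (f i).2) :=
            Real.log_lt_log (mul_pos (Real.exp_pos _) (Finset.prod_pos fun i _ => hai i))
              (not_le.1 hc)
          rw [Real.log_mul (Real.exp_pos _).ne' (Finset.prod_pos fun i _ => hai i).ne',
            Real.log_exp, blockReverse, Real.log_prod fun i _ => (hai i).ne',
            Real.log_prod fun i _ => (hri i).ne'] at h1
          have h2 : ∑ i, L (f i) = ∑ i, Real.log (reverse p (f i).1 (f i).2)
              - ∑ i, Real.log (∑ y', p (f i).2 y') := by
            rw [← Finset.sum_sub_distrib]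
            exact Finset.sum_congr rfl fun i _ => Real.log_div (hri i).ne' (hai i).ne'
          rw [Finset.sum_sub_distrib, h2]
          simp only [Finset.sum_const, Finset.card_univ, Fintype.card_fin, nsmul_eq_mul]
          linarith
        have hnd : 0 < n * δ := by positivity
        rw [← mul_pow]
        calc (∏ i, p (f i).2 (f i).1)
            = ((n * δ) ^ 2)⁻¹ * ((∏ i, p (f i).2 (f i).1) * (n * δ) ^ 2) := by field_simp
          _ ≤ _ := by gcongr
    _ = ((n : ℝ) ^ 2 * δ ^ 2)⁻¹ * (n * ∑ u : Y × X, p u.2 u.1 * (L u - I) ^ 2) := by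
        rw [← Finset.mul_sum, hcen]
        simp
    _ = _ := by field_simp

end ReverseChannel

/-! ### Existence of good codebooks -/

section Codebook

variable {X Y : Type*} [Fintype X] [Fintype Y] {n M K : ℕ}

theorem blockMarginal_nonneg {Y : Type*} {p : X → Y → ℝ} (hp : ∀ x y, 0 ≤ p x y) (y : Fin n → Y) :
    0 ≤ blockMarginal p y := Finset.prod_nonneg fun _ _ => marginal_nonneg hp _

theorem sum_blockMarginal {p : X → Y → ℝ} (hp1 : ∑ x, ∑ y, p x y = 1) :
    ∑ y : Fin n → Y, blockMarginal p y = 1 :=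
  sum_prod_weight_eq_one (p := fun _ : Fin n => marginal p) fun _ => sum_marginal hp1

theorem blockReverse_nonneg {p : X → Y → ℝ} (hp : ∀ x y, 0 ≤ p x y) (y : Fin n → Y)
    (x : Fin n → X) : 0 ≤ blockReverse p y x := Finset.prod_nonneg fun _ _ => reverse_nonneg hp _ _

theorem sum_blockReverse {p : X → Y → ℝ} (hp1 : ∑ x, ∑ y, p x y = 1) (y : Fin n → Y) :
    ∑ x : Fin n → X, blockReverse p y x = 1 :=
  sum_prod_weight_eq_one (p := fun i => reverse p (y i)) fun i => sum_reverse hp1 (y i)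

/-- The total variation between the actual and the ideal law of `(Xⁿ, K)`. -/
def coveringDeviation (p : X → Y → ℝ) (f : Fin M × Fin K → Fin n → Y) : ℝ :=
  (K : ℝ)⁻¹ * ∑ k, ∑ x : Fin n → X, |(∏ i, ∑ y, p (x i) y)
    - (M : ℝ)⁻¹ * ∑ m, blockReverse p (f (m, k)) x|

theorem coveringDeviation_nonneg (p : X → Y → ℝ) (f : Fin M × Fin K → Fin n → Y) :
    0 ≤ coveringDeviation p f := by
  unfold coveringDeviation
  positivity

/-- Soft covering is applied for each key separately, to the `M` codewords that share it; the
message rate alone must exceed the mutual information. -/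
theorem expected_coveringDeviation_le [NeZero M] [NeZero K] {p : X → Y → ℝ}
    (hp : ∀ x y, 0 ≤ p x y) (hp1 : ∑ x, ∑ y, p x y = 1) {D : ℝ} (hD : 0 ≤ D) :
    ∑ f : Fin M × Fin K → Fin n → Y, (∏ l, blockMarginal p (f l)) * coveringDeviation p f
      ≤ √(D / M) + 2 * ∑ y : Fin n → Y, ∑ x : Fin n → X, blockMarginal p y *
        (if blockReverse p y x ≤ D * ∏ i, ∑ y', p (x i) y' then 0 else blockReverse p y x) := by
  have hone := fun k : Fin K => soft_covering (ι := Fin M × Fin K)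
    (blockMarginal_nonneg (n := n) hp)
    (sum_blockMarginal hp1) (Function.Embedding.sectL (Fin M) k)
    (blockReverse_nonneg hp) (sum_blockReverse hp1) (sum_blockMarginal_mul hp) hD
  simp only [Fintype.card_fin] at hone
  calc _ = (K : ℝ)⁻¹ * ∑ k : Fin K, ∑ f : Fin M × Fin K → Fin n → Y,
        (∏ l, blockMarginal p (f l)) * ∑ x : Fin n → X, |(∏ i, ∑ y, p (x i) y)
          - (M : ℝ)⁻¹ * ∑ m, blockReverse p (f (m, k)) x| := by
        simp only [coveringDeviation]
        rw [Finset.sum_comm, Finset.mul_sum]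
        refine Finset.sum_congr rfl fun f _ => ?_
        rw [← Finset.mul_sum, mul_left_comm]
    _ ≤ _ := by
        rw [inv_mul_le_iff₀ (by exact_mod_cast Nat.pos_of_ne_zero (NeZero.ne K))]
        exact (Finset.sum_le_sum fun k _ => hone k).trans_eq
          (by rw [Finset.sum_const, Finset.card_univ, Fintype.card_fin, nsmul_eq_mul])

variable [DecidableEq Y]

/-- The deviation of the law of `(Y_i, Y_j)`, given the message `m`, from the law of the
corresponding pair of coordinates of `n` independent samples. -/
def pairDeviation (p : X → Y → ℝ) (f : Fin M × Fin K → Fin n → Y) (m : Fin M) (i j : Fin n) : ℝ :=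
  ∑ y, ∑ y', |(K : ℝ)⁻¹ * (∑ k, if f (m, k) i = y ∧ f (m, k) j = y' then 1 else 0)
    - ∑ b : Fin n → Y, blockMarginal p b * if b i = y ∧ b j = y' then 1 else 0|

/-- The average of the pair deviations over the messages. -/
def averageDeviation (p : X → Y → ℝ) (f : Fin M × Fin K → Fin n → Y) : ℝ :=
  (M : ℝ)⁻¹ * ∑ m, ∑ i, ∑ j, pairDeviation p f m i j

theorem pairDeviation_nonneg (p : X → Y → ℝ) (f : Fin M × Fin K → Fin n → Y) (m : Fin M)
    (i j : Fin n) : 0 ≤ pairDeviation p f m i j := by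
  unfold pairDeviation
  positivity

theorem averageDeviation_nonneg (p : X → Y → ℝ) (f : Fin M × Fin K → Fin n → Y) :
    0 ≤ averageDeviation p f :=
  mul_nonneg (by positivity) (Finset.sum_nonneg fun _ _ => Finset.sum_nonneg fun _ _ =>
    Finset.sum_nonneg fun _ _ => pairDeviation_nonneg _ _ _ _ _)

/-- Expanding `φ` in indicators of pairs of letters transfers the deviation to every bounded
function of two coordinates. -/
theorem abs_average_sub_le_pairDeviation (p : X → Y → ℝ) (f : Fin M × Fin K → Fin n → Y)
    (m : Fin M) (i j : Fin n) {φ : Y → Y → ℝ} {β : ℝ} (hφ : ∀ y y', |φ y y'| ≤ β) :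
    |(K : ℝ)⁻¹ * ∑ k, φ (f (m, k) i) (f (m, k) j)
      - ∑ b : Fin n → Y, blockMarginal p b * φ (b i) (b j)| ≤ β * pairDeviation p f m i j := by
  have hexp : ∀ b : Fin n → Y, φ (b i) (b j)
      = ∑ y, ∑ y', φ y y' * if b i = y ∧ b j = y' then 1 else 0 := fun b => by
    simp [ite_and, Finset.sum_ite_irrel]
  have e1 : (K : ℝ)⁻¹ * ∑ k, φ (f (m, k) i) (f (m, k) j) = ∑ y, ∑ y', φ y y' *
      ((K : ℝ)⁻¹ * ∑ k, if f (m, k) i = y ∧ f (m, k) j = y' then 1 else 0) := by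
    simp only [hexp, Finset.mul_sum]
    rw [Finset.sum_comm]
    refine Finset.sum_congr rfl fun y _ => ?_
    rw [Finset.sum_comm]
    exact Finset.sum_congr rfl fun y' _ => Finset.sum_congr rfl fun k _ => by ring
  have e2 : ∑ b : Fin n → Y, blockMarginal p b * φ (b i) (b j) = ∑ y, ∑ y', φ y y' *
      ∑ b : Fin n → Y, blockMarginal p b * if b i = y ∧ b j = y' then 1 else 0 := by
    simp only [hexp, Finset.mul_sum]
    rw [Finset.sum_comm]
    refine Finset.sum_congr rfl fun y _ => ?_
    rw [Finset.sum_comm]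
    exact Finset.sum_congr rfl fun y' _ => Finset.sum_congr rfl fun k _ => by ring
  rw [e1, e2, ← Finset.sum_sub_distrib, pairDeviation, Finset.mul_sum]
  refine (Finset.abs_sum_le_sum_abs _ _).trans (Finset.sum_le_sum fun y _ => ?_)
  rw [← Finset.sum_sub_distrib, Finset.mul_sum]
  refine (Finset.abs_sum_le_sum_abs _ _).trans (Finset.sum_le_sum fun y' _ => ?_)
  rw [← mul_sub, abs_mul]
  exact mul_le_mul_of_nonneg_right (hφ y y') (abs_nonneg _)

/-- For fixed `m` the `K` codewords are independent samples, so every indicator has mean absolute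
deviation at most `√(1/K)`. There are `n²` coordinate pairs and `|Y|²` letter pairs. -/
theorem expected_averageDeviation_le [NeZero M] [NeZero K] {p : X → Y → ℝ}
    (hp : ∀ x y, 0 ≤ p x y) (hp1 : ∑ x, ∑ y, p x y = 1) :
    ∑ f : Fin M × Fin K → Fin n → Y, (∏ l, blockMarginal p (f l)) * averageDeviation p f
      ≤ (n : ℝ) ^ 2 * (Fintype.card Y : ℝ) ^ 2 * √(1 / K) := by
  have hM : (M : ℝ) ≠ 0 := by exact_mod_cast NeZero.ne M
  have hone : ∀ (m : Fin M) (i j : Fin n) (y y' : Y),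
      ∑ f : Fin M × Fin K → Fin n → Y, (∏ l, blockMarginal p (f l)) *
        |(K : ℝ)⁻¹ * (∑ k, if f (m, k) i = y ∧ f (m, k) j = y' then 1 else 0)
          - ∑ b : Fin n → Y, blockMarginal p b * if b i = y ∧ b j = y' then 1 else 0|
        ≤ √(1 / K) := by
    intro m i j y y'
    have h := sum_prod_weight_mul_abs_average_comp_sub_le (blockMarginal_nonneg (n := n) hp)
      (sum_blockMarginal hp1) (Function.Embedding.sectR m (Fin K))
      (fun b => if b i = y ∧ b j = y' then 1 else 0)
    rw [Fintype.card_fin] at h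
    refine h.trans (Real.sqrt_le_sqrt (div_le_div_of_nonneg_right ?_ (by positivity)))
    refine (Finset.sum_le_sum fun b _ => mul_le_of_le_one_right (blockMarginal_nonneg hp b)
      ?_).trans_eq (sum_blockMarginal hp1)
    split_ifs <;> norm_num
  calc _ = (M : ℝ)⁻¹ * ∑ m : Fin M, ∑ i : Fin n, ∑ j : Fin n, ∑ y, ∑ y',
        ∑ f : Fin M × Fin K → Fin n → Y, (∏ l, blockMarginal p (f l)) *
        |(K : ℝ)⁻¹ * (∑ k, if f (m, k) i = y ∧ f (m, k) j = y' then 1 else 0)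
          - ∑ b : Fin n → Y, blockMarginal p b * if b i = y ∧ b j = y' then 1 else 0| := by
        simp only [averageDeviation, pairDeviation, Finset.mul_sum]
        simp_rw [Finset.sum_comm (s := (Finset.univ : Finset (Fin M × Fin K → Fin n → Y)))]
        congr! 5
        exact Finset.sum_congr rfl fun f _ => by ring
    _ ≤ (M : ℝ)⁻¹ * ∑ _m : Fin M, ∑ _i : Fin n, ∑ _j : Fin n, ∑ _y : Y, ∑ _y' : Y, √(1 / K) := by
        gcongr
        exact hone _ _ _ _ _
    _ = _ := by
        simp only [Finset.sum_const, Finset.card_univ, Fintype.card_fin, nsmul_eq_mul]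
        field_simp

/-- Both deviations are bounded in a single expectation, so one codebook serves both. -/
theorem exists_codebook [NeZero M] [NeZero K] {p : X → Y → ℝ}
    (hp : ∀ x y, 0 ≤ p x y) (hp1 : ∑ x, ∑ y, p x y = 1) {D : ℝ} (hD : 0 ≤ D) :
    ∃ f : Fin M × Fin K → Fin n → Y, (∀ l i, 0 < marginal p (f l i)) ∧
      coveringDeviation p f + averageDeviation p f ≤
        √(D / M) + 2 * ∑ y : Fin n → Y, ∑ x : Fin n → X, blockMarginal p y *
          (if blockReverse p y x ≤ D * ∏ i, ∑ y', p (x i) y' then 0 else blockReverse p y x)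
        + (n : ℝ) ^ 2 * (Fintype.card Y : ℝ) ^ 2 * √(1 / K) := by
  obtain ⟨f, hf, hle⟩ := exists_pos_weight_le
    (w := fun f : Fin M × Fin K → Fin n → Y => ∏ l, blockMarginal p (f l))
    (F := fun f => coveringDeviation p f + averageDeviation p f)
    (fun f => Finset.prod_nonneg fun l _ => blockMarginal_nonneg hp _)
    (sum_prod_weight_eq_one (p := fun _ => blockMarginal p) fun _ => sum_blockMarginal hp1)
    (b := √(D / M) + 2 * ∑ y : Fin n → Y, ∑ x : Fin n → X, blockMarginal p y *
          (if blockReverse p y x ≤ D * ∏ i, ∑ y', p (x i) y' then 0 else blockReverse p y x)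
        + (n : ℝ) ^ 2 * (Fintype.card Y : ℝ) ^ 2 * √(1 / K)) (by
      simp only [mul_add, Finset.sum_add_distrib]
      exact add_le_add (expected_coveringDeviation_le hp hp1 hD)
        (expected_averageDeviation_le hp hp1))
  refine ⟨f, fun l i => (marginal_nonneg hp _).lt_of_ne fun h => hf.ne' ?_, hle⟩
  -- A single letter of marginal mass zero would make the weight of the whole codebook vanish.
  exact Finset.prod_eq_zero (Finset.mem_univ l) (Finset.prod_eq_zero (Finset.mem_univ i) h.symm)

theorem indexSize_pos_of_nonneg (n : ℕ) {R : ℝ} (hR : 0 ≤ R) : 0 < indexSize n R := by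
  rw [indexSize, Nat.floor_pos]
  exact Real.one_le_rpow one_le_two (by positivity)

/-- Rounding down a number that is at least one loses at most a factor two. -/
theorem inv_indexSize_le (n : ℕ) {R : ℝ} (hR : 0 ≤ R) :
    1 / (indexSize n R : ℝ) ≤ 2 * Real.exp (-(n * R * Real.log 2)) := by
  have h1 : (1 : ℝ) ≤ 2 ^ ((n : ℝ) * R) := Real.one_le_rpow one_le_two (by positivity)
  have h2 : (2 : ℝ) ^ ((n : ℝ) * R) = Real.exp (n * R * Real.log 2) := by
    rw [Real.rpow_def_of_pos two_pos, mul_comm]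
  have h3 := Nat.lt_floor_add_one ((2 : ℝ) ^ ((n : ℝ) * R))
  have h4 : (1 : ℝ) ≤ indexSize n R := by exact_mod_cast indexSize_pos_of_nonneg n hR
  have h5 : (2 : ℝ) ^ ((n : ℝ) * R) < indexSize n R + 1 := h3
  rw [Real.exp_neg, ← h2, ← div_eq_mul_inv, div_le_div_iff₀ (by linarith) (by linarith)]
  linarith

/-- Good codebooks exist for every message rate above the mutual information and every positive
key rate. -/
theorem exists_codebook_sequence {p : X → Y → ℝ}
    (hp : ∀ x y, 0 ≤ p x y) (hp1 : ∑ x, ∑ y, p x y = 1) {R R₀ : ℝ} (hR : info p < R)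
    (hR₀ : 0 < R₀) :
    ∃ f : ∀ n : ℕ, Fin (indexSize n R) × Fin (indexSize n R₀) → Fin n → Y,
      (∀ n l i, 0 < marginal p (f n l i)) ∧
      Tendsto (fun n => coveringDeviation p (f n)) atTop (𝓝 0) ∧
      Tendsto (fun n => averageDeviation p (f n)) atTop (𝓝 0) := by
  have hRpos : 0 < R := (info_nonneg hp hp1).trans_lt hR
  have hl : 0 < Real.log 2 := Real.log_pos (by norm_num)
  -- Half of the rate gap, in nats: the threshold exponent exceeds the information by `δ` and stays
  -- below the rate by `δ`, so `D / M` decays like `exp(-δ n)`.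
  set δ := (R - info p) * Real.log 2 / 2 with hδ
  have hδ0 : 0 < δ := div_pos (mul_pos (sub_pos.2 hR) hl) two_pos
  obtain ⟨C, hC⟩ := exists_atypical_le hp hp1 hδ0
  have hex := fun n : ℕ =>
    haveI : NeZero (indexSize n R) := ⟨(indexSize_pos_of_nonneg n hRpos.le).ne'⟩
    haveI : NeZero (indexSize n R₀) := ⟨(indexSize_pos_of_nonneg n hR₀.le).ne'⟩
    exists_codebook (n := n) (M := indexSize n R) (K := indexSize n R₀) hp hp1
      (D := Real.exp (n * (info p * Real.log 2 + δ))) (Real.exp_pos _).le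
  choose f hf1 hf2 using hex
  have hexp : ∀ (k : ℕ) (a : ℝ), 0 < a →
      Tendsto (fun n : ℕ => (n : ℝ) ^ k * Real.exp (-(a * n))) atTop (𝓝 0) := by
    intro k a ha
    have h := (((Real.tendsto_pow_mul_exp_neg_atTop_nhds_zero k).comp
      (tendsto_natCast_atTop_atTop.const_mul_atTop ha)).const_mul (a ^ k)⁻¹)
    rw [mul_zero] at h
    refine h.congr fun n => ?_
    have : a ^ k ≠ 0 := pow_ne_zero _ ha.ne'
    simp only [Function.comp_apply, mul_pow]
    field_simp
  have hbound : ∀ n : ℕ, 0 < n → coveringDeviation p (f n) + averageDeviation p (f n) ≤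
      √(2 * Real.exp (-(δ * n))) + 2 * (C / n)
        + (Fintype.card Y : ℝ) ^ 2 * √(2 * ((n : ℝ) ^ 4 * Real.exp (-(R₀ * Real.log 2 * n)))) := by
    intro n hn
    refine (hf2 n).trans (add_le_add (add_le_add ?_ ?_) ?_)
    · refine Real.sqrt_le_sqrt ?_
      rw [div_eq_mul_one_div]
      calc _ ≤ Real.exp (n * (info p * Real.log 2 + δ)) *
            (2 * Real.exp (-(n * R * Real.log 2))) :=
            mul_le_mul_of_nonneg_left (inv_indexSize_le n hRpos.le) (Real.exp_pos _).le
        _ = 2 * Real.exp (-(δ * n)) := by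
            rw [mul_left_comm, ← Real.exp_add, hδ]
            ring_nf
    · exact mul_le_mul_of_nonneg_left (hC n hn) two_pos.le
    -- The factor `n²` is moved under the root as `n⁴`, where the exponentially large key set beats
    -- it.
    · have h4 : (n : ℝ) ^ 2 = √((n : ℝ) ^ 4) := by
        rw [show (n : ℝ) ^ 4 = ((n : ℝ) ^ 2) ^ 2 by ring, Real.sqrt_sq (by positivity)]
      rw [mul_comm ((n : ℝ) ^ 2), mul_assoc, h4, ← Real.sqrt_mul (by positivity)]
      refine mul_le_mul_of_nonneg_left (Real.sqrt_le_sqrt ?_) (by positivity)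
      calc _ ≤ (n : ℝ) ^ 4 * (2 * Real.exp (-(n * R₀ * Real.log 2))) :=
            mul_le_mul_of_nonneg_left (inv_indexSize_le n hR₀.le) (by positivity)
        _ = _ := by
            rw [mul_left_comm]
            ring_nf
  have hlim : Tendsto (fun n : ℕ => √(2 * Real.exp (-(δ * n))) + 2 * (C / n)
        + (Fintype.card Y : ℝ) ^ 2 * √(2 * ((n : ℝ) ^ 4 * Real.exp (-(R₀ * Real.log 2 * n)))))
      atTop (𝓝 0) := by
    have h1 := ((hexp 0 δ hδ0).const_mul 2).sqrt
    have h2 := (tendsto_const_div_atTop_nhds_zero_nat C).const_mul 2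
    have h3 := (((hexp 4 (R₀ * Real.log 2) (mul_pos hR₀ hl)).const_mul 2).sqrt).const_mul
      ((Fintype.card Y : ℝ) ^ 2)
    simpa using (h1.add h2).add h3
  refine ⟨f, hf1, ?_, ?_⟩
  · refine squeeze_zero' (Eventually.of_forall fun n => coveringDeviation_nonneg p (f n)) ?_ hlim
    filter_upwards [eventually_gt_atTop 0] with n hn
    linarith [hbound n hn, averageDeviation_nonneg p (f n)]
  · refine squeeze_zero' (Eventually.of_forall fun n => averageDeviation_nonneg p (f n)) ?_ hlim
    filter_upwards [eventually_gt_atTop 0] with n hn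
    linarith [hbound n hn, coveringDeviation_nonneg p (f n)]

end Codebook

/-! ### Reduction of randomized strategies to deterministic ones -/

section StochasticStrategies

variable {Z Ω : Type*} [Fintype Z]

theorem summable_toReal (p : PMF Ω) : Summable fun ω => (p ω).toReal :=
  ENNReal.summable_toReal p.tsum_coe_ne_top

theorem mean_bind_eq_tsum (p : PMF Ω) (s : Ω → PMF Z) (g : Z → ℝ) :
    mean (p.bind s) g = ∑' ω, (p ω).toReal * mean (s ω) g := by
  have hs : ∀ z, Summable fun ω => (p ω).toReal * ((s ω z).toReal * g z) := fun z => by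
    refine Summable.of_norm_bounded ((summable_toReal p).mul_right |g z|) fun ω => ?_
    rw [Real.norm_eq_abs, abs_mul, abs_mul, abs_of_nonneg ENNReal.toReal_nonneg,
      abs_of_nonneg ENNReal.toReal_nonneg]
    exact mul_le_mul_of_nonneg_left (mul_le_of_le_one_left (abs_nonneg _) (toReal_le_one _ _))
      ENNReal.toReal_nonneg
  simp only [mean, Finset.mul_sum]
  rw [Summable.tsum_finsetSum fun z _ => hs z]
  refine Finset.sum_congr rfl fun z _ => ?_
  rw [PMF.bind_apply, ENNReal.tsum_toReal_eq fun ω =>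
    ENNReal.mul_ne_top (p.apply_ne_top ω) ((s ω).apply_ne_top z), ← tsum_mul_right]
  exact tsum_congr fun ω => by rw [ENNReal.toReal_mul, mul_assoc]

theorem abs_mean_le (p : PMF Z) {g : Z → ℝ} {B : ℝ} (hg : ∀ z, |g z| ≤ B) : |mean p g| ≤ B := by
  rw [abs_le]
  constructor
  · rw [← mean_const p (-B)]
    exact mean_mono p fun z _ => (abs_le.1 (hg z)).1
  · rw [← mean_const p B]
    exact mean_mono p fun z _ => (abs_le.1 (hg z)).2

/-- Randomized estimators do no better than the best deterministic one. -/
theorem exists_deterministic_le {T : Type*} [Fintype T] [Nonempty Z] (p : T → ℝ) (ν : T → PMF Ω)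
    (g : T → Z → ℝ) (s : Ω → PMF Z) :
    ∃ z : Ω → Z, ∑ t, p t * mean ((ν t).bind fun ω => PMF.pure (z ω)) (g t)
      ≤ ∑ t, p t * mean ((ν t).bind s) (g t) := by
  -- For each observation, `z` minimizes the unnormalized posterior payoff; any randomization
  -- averages values that are no smaller.
  have hmin : ∀ ω, ∃ z₀, ∀ z, ∑ t, p t * (ν t ω).toReal * g t z₀
      ≤ ∑ t, p t * (ν t ω).toReal * g t z := fun ω =>
    Finite.exists_min fun z => ∑ t, p t * (ν t ω).toReal * g t z
  choose z hz using hmin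
  have hform : ∀ s : Ω → PMF Z, (∀ t, Summable fun ω => p t * ((ν t ω).toReal * mean (s ω) (g t))) ∧
      ∑ t, p t * mean ((ν t).bind s) (g t)
        = ∑' ω, ∑ t, p t * ((ν t ω).toReal * mean (s ω) (g t)) := by
    intro s
    have hs : ∀ t, Summable fun ω => p t * ((ν t ω).toReal * mean (s ω) (g t)) := fun t => by
      refine Summable.mul_left _ ?_
      refine Summable.of_norm_bounded ((summable_toReal (ν t)).mul_right (∑ z, |g t z|))
        fun ω => ?_
      rw [Real.norm_eq_abs, abs_mul, abs_of_nonneg ENNReal.toReal_nonneg]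
      exact mul_le_mul_of_nonneg_left (abs_mean_le _ fun z =>
        Finset.single_le_sum (f := fun z => |g t z|) (fun _ _ => abs_nonneg _) (Finset.mem_univ z))
        ENNReal.toReal_nonneg
    refine ⟨hs, ?_⟩
    rw [Summable.tsum_finsetSum fun t _ => hs t]
    exact Finset.sum_congr rfl fun t _ => by rw [mean_bind_eq_tsum, tsum_mul_left]
  refine ⟨z, ?_⟩
  rw [(hform s).2, (hform fun ω => PMF.pure (z ω)).2]
  refine Summable.tsum_le_tsum (fun ω => ?_) (summable_sum fun t _ => (hform _).1 t)
    (summable_sum fun t _ => (hform _).1 t)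
  have e : ∑ t, p t * ((ν t ω).toReal * mean (s ω) (g t))
      = mean (s ω) fun w => ∑ t, p t * (ν t ω).toReal * g t w := by
    rw [mean_sum]
    exact Finset.sum_congr rfl fun t _ => by rw [mean_mul_left, mul_assoc]
  rw [e, ← mean_const (s ω) (∑ t, p t * ((ν t ω).toReal * mean (PMF.pure (z ω)) (g t)))]
  refine mean_mono _ fun w _ => ?_
  simp only [mean_pure, ← mul_assoc]
  exact hz ω w

/-- Given the message, the adversary's rule is a randomized function of `W_i`; this extends the
single-letter guarantee to such rules. -/
theorem le_sum_mean_effectiveChannel {X Y Wx Wy : Type*} [Fintype X] [Fintype Y] [Nonempty Z]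
    (PWx : X → PMF Wx) (PWy : Y → PMF Wy) {p : X → Y → ℝ} {f : X → Y → Z → ℝ} {P : ℝ}
    (hP : ∀ z : Wx × Wy → Z, P ≤ ∑ x, ∑ y, p x y * ∑ w, pureKernel PWx PWy z x y w * f x y w)
    (s : Wx × Wy → PMF Z) :
    P ≤ ∑ x, ∑ y, p x y * mean (effectiveChannel PWx PWy s x y) (f x y) := by
  set ν : X × Y → PMF (Wx × Wy) := fun t => (PWx t.1).bind fun wx => (PWy t.2).map (Prod.mk wx)
  have hν : ∀ (s : Wx × Wy → PMF Z) (t : X × Y), effectiveChannel PWx PWy s t.1 t.2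
      = (ν t).bind s := fun s t => by
    simp only [ν, effectiveChannel, PMF.bind_bind, PMF.bind_map]
    rfl
  obtain ⟨z, hz⟩ := exists_deterministic_le (fun t : X × Y => p t.1 t.2) ν (fun t => f t.1 t.2) s
  simp only [← hν] at hz
  rw [Fintype.sum_prod_type, Fintype.sum_prod_type] at hz
  exact (hP z).trans hz

end StochasticStrategies

/-! ### The likelihood encoder and the idealized law -/

section LikelihoodCode

variable {X Y : Type*} [Fintype X] [Fintype Y] {n : ℕ} {R R₀ : ℝ}

/-- Multiplying by the normalizer keeps the identity valid when all likelihoods vanish, where any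
message will do. -/
theorem exists_likelihood_encoder {p : X → Y → ℝ} (hp : ∀ x y, 0 ≤ p x y) (hM : 0 < indexSize n R)
    (f : Fin (indexSize n R) × Fin (indexSize n R₀) → Fin n → Y) :
    ∃ enc : (Fin n → X) → Fin (indexSize n R₀) → PMF (Fin (indexSize n R)), ∀ x k m,
      (∑ m', blockReverse p (f (m', k)) x) * (enc x k m).toReal = blockReverse p (f (m, k)) x := by
  have key : ∀ (x : Fin n → X) (k : Fin (indexSize n R₀)), ∃ q : PMF (Fin (indexSize n R)), ∀ m,
      (∑ m', blockReverse p (f (m', k)) x) * (q m).toReal = blockReverse p (f (m, k)) x := by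
    intro x k
    by_cases h : ∑ m', blockReverse p (f (m', k)) x = 0
    · refine ⟨PMF.pure ⟨0, hM⟩, fun m => ?_⟩
      rw [h, zero_mul]
      exact (((Finset.sum_eq_zero_iff_of_nonneg fun _ _ => blockReverse_nonneg hp _ _).1 h) m
        (Finset.mem_univ m)).symm
    · obtain ⟨q, hq⟩ := exists_pmf_toReal_eq
        (w := fun m => blockReverse p (f (m, k)) x / ∑ m', blockReverse p (f (m', k)) x)
        (fun m => div_nonneg (blockReverse_nonneg hp _ _)
          (Finset.sum_nonneg fun _ _ => blockReverse_nonneg hp _ _))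
        (by rw [← Finset.sum_div, div_self h])
      exact ⟨q, fun m => by rw [hq, mul_div_cancel₀ _ h]⟩
  choose enc henc using key
  exact ⟨enc, henc⟩

/-- The code with a given codebook and the likelihood encoder. -/
def likelihoodCode {p : X → Y → ℝ} (hp : ∀ x y, 0 ≤ p x y) (hM : 0 < indexSize n R)
    (hK : 0 < indexSize n R₀) (f : Fin (indexSize n R) × Fin (indexSize n R₀) → Fin n → Y) :
    Code X Y n R R₀ where
  key_pos := hK
  encoder := (exists_likelihood_encoder hp hM f).choose
  decoder m k := PMF.pure (f (m, k))

theorem mean_keyLaw {X Y : Type*} (c : Code X Y n R R₀) (g : Fin (indexSize n R₀) → ℝ) :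
    mean c.keyLaw g = (indexSize n R₀ : ℝ)⁻¹ * ∑ k, g k := by
  rw [mean, Finset.mul_sum]
  refine Finset.sum_congr rfl fun k _ => ?_
  simp [Code.keyLaw]

/-- The expectation under the idealized law: the message and the key are uniform and `Xⁿ` is the
output of the reverse channel. -/
def idealMean {M K : ℕ} (p : X → Y → ℝ) (f : Fin M × Fin K → Fin n → Y)
    (G : (Fin n → X) → (Fin n → Y) → Fin M → ℝ) : ℝ :=
  (M : ℝ)⁻¹ * ∑ m, (K : ℝ)⁻¹ * ∑ k, ∑ x, blockReverse p (f (m, k)) x * G x (f (m, k)) m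

/-- The likelihood encoder is the posterior of the message under the idealized law. The two laws
therefore share the conditional law of everything given `(Xⁿ, K)` and differ only in the law of that
pair, which `coveringDeviation` measures. -/
theorem abs_mean_codeLaw_sub_idealMean_le {PX : PMF X} {p : X → Y → ℝ}
    (hp : p ∈ couplings fun x => (PX x).toReal) (hM : 0 < indexSize n R)
    (hK : 0 < indexSize n R₀) (f : Fin (indexSize n R) × Fin (indexSize n R₀) → Fin n → Y)
    {G : (Fin n → X) → (Fin n → Y) → Fin (indexSize n R) → ℝ} {B : ℝ}
    (hG : ∀ x y m, |G x y m| ≤ B) :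
    |mean (codeLaw PX (likelihoodCode hp.1 hM hK f)) (fun t => G t.1 t.2.1 t.2.2)
      - idealMean p f G| ≤ B * coveringDeviation p f := by
  obtain ⟨hp0, hp1⟩ := hp
  set c := likelihoodCode hp0 hM hK f with hc
  have henc : ∀ x k m, (∑ m', blockReverse p (f (m', k)) x) * (c.encoder x k m).toReal
      = blockReverse p (f (m, k)) x := (exists_likelihood_encoder hp0 hM f).choose_spec
  set U : (Fin n → X) → Fin (indexSize n R₀) → ℝ := fun x k =>
    mean (c.encoder x k) fun m => G x (f (m, k)) m with hU
  have h1 : mean (codeLaw PX c) (fun t => G t.1 t.2.1 t.2.2) = (indexSize n R₀ : ℝ)⁻¹ *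
      ∑ k, ∑ x : Fin n → X, (∏ i, ∑ y, p (x i) y) * U x k := by
    have hdec : ∀ m k, c.decoder m k = PMF.pure (f (m, k)) := fun _ _ => rfl
    rw [mean_codeLaw]
    simp only [hdec, mean_pure]
    rw [mean_comm, mean_keyLaw]
    simp only [mean, toReal_productPMF, hp1, hU]
  have h2 : idealMean p f G = (indexSize n R₀ : ℝ)⁻¹ * ∑ k, ∑ x : Fin n → X,
      ((indexSize n R : ℝ)⁻¹ * ∑ m, blockReverse p (f (m, k)) x) * U x k := by
    simp only [idealMean, hU, mean, Finset.mul_sum]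
    rw [Finset.sum_comm]
    refine Finset.sum_congr rfl fun k _ => ?_
    rw [Finset.sum_comm]
    refine Finset.sum_congr rfl fun x _ => Finset.sum_congr rfl fun m _ => ?_
    rw [← Finset.mul_sum, ← henc x k m]
    ring
  rw [h1, h2, ← mul_sub, ← Finset.sum_sub_distrib, abs_mul,
    abs_of_nonneg (inv_nonneg.2 (Nat.cast_nonneg _)), coveringDeviation, mul_left_comm]
  refine mul_le_mul_of_nonneg_left ?_ (inv_nonneg.2 (Nat.cast_nonneg _))
  rw [Finset.mul_sum]
  refine (Finset.abs_sum_le_sum_abs _ _).trans (Finset.sum_le_sum fun k _ => ?_)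
  rw [← Finset.sum_sub_distrib, Finset.mul_sum]
  refine (Finset.abs_sum_le_sum_abs _ _).trans (Finset.sum_le_sum fun x _ => ?_)
  rw [← sub_mul, abs_mul, mul_comm]
  exact mul_le_mul_of_nonneg_right (abs_mean_le _ fun m => hG _ _ _) (abs_nonneg _)

end LikelihoodCode

/-! ### First and second moments under the idealized law -/

section IdealLaw

variable {X Y Z : Type*} [Fintype X] [Fintype Y] [DecidableEq Y] [Fintype Z] {n M K : ℕ}

theorem sum_blockMarginal_mul_coordinate {Y : Type*} [Fintype Y] {p : X → Y → ℝ}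
    (hp : ∀ x y, 0 ≤ p x y) (hp1 : ∑ x, ∑ y, p x y = 1) (i : Fin n) (h : X → Y → ℝ) :
    ∑ b : Fin n → Y, blockMarginal p b * ∑ x, reverse p (b i) x * h x (b i)
      = ∑ x, ∑ y, p x y * h x y := by
  have h1 := sum_prod_weight_mul (p := fun _ : Fin n => marginal p) (fun _ => sum_marginal hp1) i
    fun y => ∑ x, reverse p y x * h x y
  refine h1.trans ?_
  simp only [Finset.mul_sum, ← mul_assoc, marginal_mul_reverse hp]
  rw [Finset.sum_comm]

theorem abs_sum_reverse_mul_le {Y : Type*} [Fintype Y] {p : X → Y → ℝ} (hp : ∀ x y, 0 ≤ p x y)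
    (hp1 : ∑ x, ∑ y, p x y = 1) (y : Y) {h : X → ℝ} {β : ℝ} (hh : ∀ x, |h x| ≤ β) :
    |∑ x, reverse p y x * h x| ≤ β := by
  refine (Finset.abs_sum_le_sum_abs _ _).trans ?_
  calc ∑ x, |reverse p y x * h x| ≤ ∑ x, reverse p y x * β := by
        refine Finset.sum_le_sum fun x _ => ?_
        rw [abs_mul, abs_of_nonneg (reverse_nonneg hp y x)]
        exact mul_le_mul_of_nonneg_left (hh x) (reverse_nonneg hp y x)
    _ = β := by rw [← Finset.sum_mul, sum_reverse hp1, one_mul]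

/-- Given `m`, averaging over the key brings the law of `Y_i` close to the marginal, so `(X_i, Y_i)`
has nearly law `p` for every message. The diagonal `i = j` of the pair deviation covers one
coordinate. -/
theorem le_idealMean_coordinate [NeZero M] {p : X → Y → ℝ} (hp : ∀ x y, 0 ≤ p x y)
    (hp1 : ∑ x, ∑ y, p x y = 1) (f : Fin M × Fin K → Fin n → Y) (i : Fin n)
    {h : Fin M → X → Y → ℝ} {B P : ℝ} (hB0 : 0 ≤ B) (hB : ∀ m x y, |h m x y| ≤ B)
    (hP : ∀ m, P ≤ ∑ x, ∑ y, p x y * h m x y) :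
    P - B * averageDeviation p f ≤ idealMean p f fun x y m => h m (x i) (y i) := by
  have hM : (0 : ℝ) < M := by exact_mod_cast Nat.pos_of_ne_zero (NeZero.ne M)
  have hm : ∀ m, P - B * ∑ i, ∑ j, pairDeviation p f m i j ≤ (K : ℝ)⁻¹ * ∑ k, ∑ x,
      blockReverse p (f (m, k)) x * h m (x i) (f (m, k) i) := by
    intro m
    have h1 : ∀ b : Fin n → Y, ∑ x, blockReverse p b x * h m (x i) (b i)
        = ∑ x, reverse p (b i) x * h m x (b i) := fun b =>
      sum_prod_weight_mul (p := fun l => reverse p (b l)) (fun l => sum_reverse hp1 (b l)) i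
        fun x => h m x (b i)
    simp only [h1]
    have h2 := abs_average_sub_le_pairDeviation p f m i i
      (φ := fun y _ => ∑ x, reverse p y x * h m x y)
      (fun y _ => abs_sum_reverse_mul_le hp hp1 y fun x => hB m x y)
    rw [sum_blockMarginal_mul_coordinate hp hp1] at h2
    have h3 : pairDeviation p f m i i ≤ ∑ i, ∑ j, pairDeviation p f m i j :=
      (Finset.single_le_sum (f := fun j => pairDeviation p f m i j)
        (fun _ _ => pairDeviation_nonneg _ _ _ _ _) (Finset.mem_univ i)).trans
      (Finset.single_le_sum (f := fun i => ∑ j, pairDeviation p f m i j)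
        (fun _ _ => Finset.sum_nonneg fun _ _ => pairDeviation_nonneg _ _ _ _ _)
        (Finset.mem_univ i))
    have h4 := mul_le_mul_of_nonneg_left h3 hB0
    linarith [(abs_le.1 h2).1, hP m]
  calc P - B * averageDeviation p f
      = (M : ℝ)⁻¹ * ∑ m, (P - B * ∑ i, ∑ j, pairDeviation p f m i j) := by
        rw [Finset.sum_sub_distrib, ← Finset.mul_sum, averageDeviation]
        simp only [Finset.sum_const, Finset.card_univ, Fintype.card_fin, nsmul_eq_mul]
        field_simp
    _ ≤ _ := mul_le_mul_of_nonneg_left (Finset.sum_le_sum fun m _ => hm m) (inv_nonneg.2 hM.le)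

/-- For a fixed codeword the pairs `(X_i, Z_i)` are independent, so off-diagonal terms factor into
conditional means given the letters of `b`. -/
theorem sum_blockReverse_mul_mean_sq {Y : Type*} [Fintype Y] {p : X → Y → ℝ}
    (hp : ∀ x y, 0 ≤ p x y) (hp1 : ∑ x, ∑ y, p x y = 1) (b : Fin n → Y)
    (κ : Fin n → X → Y → PMF Z) {T : Fin n → X → Y → Z → ℝ} {β : ℝ}
    (hT : ∀ i x y z, |T i x y z| ≤ β) :
    ∑ x, blockReverse p b x * mean (productPMF fun i => κ i (x i) (b i))
        (fun z => (∑ i, T i (x i) (b i) (z i)) ^ 2)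
      ≤ ∑ i, ∑ j, if i = j then β ^ 2 else
        (∑ x, reverse p (b i) x * mean (κ i x (b i)) (T i x (b i))) *
        ∑ x, reverse p (b j) x * mean (κ j x (b j)) (T j x (b j)) := by
  set w : Fin n → X × Z → ℝ := fun i u => reverse p (b i) u.1 * (κ i u.1 (b i) u.2).toReal with hw
  have hw1 : ∀ i, ∑ u, w i u = 1 := fun i => by
    rw [Fintype.sum_prod_type]
    simp only [hw, ← Finset.mul_sum, sum_toReal_eq_one, mul_one, sum_reverse hp1]
  have hw0 : ∀ i u, 0 ≤ w i u := fun i u =>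
    mul_nonneg (reverse_nonneg hp _ _) ENNReal.toReal_nonneg
  have h1 : ∑ x, blockReverse p b x * mean (productPMF fun i => κ i (x i) (b i))
        (fun z => (∑ i, T i (x i) (b i) (z i)) ^ 2)
      = ∑ u : Fin n → X × Z, (∏ i, w i (u i)) * (∑ i, T i (u i).1 (b i) (u i).2) ^ 2 := by
    simp only [mean, Finset.mul_sum]
    rw [sum_sum_eq_sum_pair]
    refine Finset.sum_congr rfl fun u _ => ?_
    rw [toReal_productPMF, blockReverse, ← mul_assoc, ← Finset.prod_mul_distrib]
  rw [h1, sum_prod_weight_mul_sq hw1 fun i u => T i u.1 (b i) u.2]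
  refine Finset.sum_le_sum fun i _ => Finset.sum_le_sum fun j _ => ?_
  split_ifs with hij
  · calc _ ≤ ∑ u, w i u * β ^ 2 := Finset.sum_le_sum fun u _ =>
          mul_le_mul_of_nonneg_left (sq_le_sq' (abs_le.1 (hT _ _ _ _)).1 (abs_le.1 (hT _ _ _ _)).2)
            (hw0 i u)
      _ = β ^ 2 := by rw [← Finset.sum_mul, hw1, one_mul]
  · have e : ∀ i, ∑ u, w i u * T i u.1 (b i) u.2
        = ∑ x, reverse p (b i) x * mean (κ i x (b i)) (T i x (b i)) := fun i => by
      rw [Fintype.sum_prod_type]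
      simp only [hw, mean, Finset.mul_sum, mul_assoc]
    rw [e, e]

/-- For independent letters the off-diagonal products would have mean zero by `hT0`. Averaging over
the key reproduces this up to `β²` times the pair deviation, and the diagonal contributes `n β²`. -/
theorem idealMean_sq_le [NeZero M] [NeZero K] {p : X → Y → ℝ} (hp : ∀ x y, 0 ≤ p x y)
    (hp1 : ∑ x, ∑ y, p x y = 1) (f : Fin M × Fin K → Fin n → Y)
    (κ : Fin M → Fin n → X → Y → PMF Z) {T : Fin M → Fin n → X → Y → Z → ℝ} {β : ℝ}
    (hβ : 0 ≤ β) (hT : ∀ m i x y z, |T m i x y z| ≤ β)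
    (hT0 : ∀ m i, ∑ x, ∑ y, p x y * mean (κ m i x y) (T m i x y) = 0) :
    (idealMean p f fun x y m => mean (productPMF fun i => κ m i (x i) (y i))
        fun z => (∑ i, T m i (x i) (y i) (z i)) ^ 2)
      ≤ β ^ 2 * (n + averageDeviation p f) := by
  have hM : (0 : ℝ) < M := by exact_mod_cast Nat.pos_of_ne_zero (NeZero.ne M)
  have hK : (0 : ℝ) < K := by exact_mod_cast Nat.pos_of_ne_zero (NeZero.ne K)
  set H : Fin M → Fin n → Y → ℝ := fun m i y =>
    ∑ x, reverse p y x * mean (κ m i x y) (T m i x y) with hH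
  have hH1 : ∀ m i y, |H m i y| ≤ β := fun m i y =>
    abs_sum_reverse_mul_le hp hp1 y fun x => abs_mean_le _ fun z => hT _ _ _ _ _
  have hpair : ∀ m i j, i ≠ j → (K : ℝ)⁻¹ * ∑ k, H m i (f (m, k) i) * H m j (f (m, k) j)
      ≤ β ^ 2 * pairDeviation p f m i j := by
    intro m i j hij
    have h1 := abs_average_sub_le_pairDeviation p f m i j (φ := fun y y' => H m i y * H m j y')
      (β := β ^ 2) fun y y' => by
        rw [abs_mul, sq]
        exact mul_le_mul (hH1 _ _ _) (hH1 _ _ _) (abs_nonneg _) hβ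
    have h2 : ∑ b : Fin n → Y, blockMarginal p b * (H m i (b i) * H m j (b j)) = 0 := by
      refine (sum_prod_weight_mul_mul (p := fun _ : Fin n => marginal p)
        (fun _ => sum_marginal hp1) hij (H m i) (H m j)).trans ?_
      have h3 : ∑ y, marginal p y * H m i y = 0 := by
        rw [← hT0 m i]
        simp only [hH, Finset.mul_sum, ← mul_assoc, marginal_mul_reverse hp]
        rw [Finset.sum_comm]
      rw [h3, zero_mul]
    rw [h2, sub_zero] at h1
    exact (le_abs_self _).trans h1
  have hm : ∀ m, (K : ℝ)⁻¹ * ∑ k, ∑ x, blockReverse p (f (m, k)) x *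
      mean (productPMF fun i => κ m i (x i) (f (m, k) i))
        (fun z => (∑ i, T m i (x i) (f (m, k) i) (z i)) ^ 2)
      ≤ β ^ 2 * (n + ∑ i, ∑ j, pairDeviation p f m i j) := by
    intro m
    calc _ ≤ (K : ℝ)⁻¹ * ∑ k, ∑ i, ∑ j, (if i = j then β ^ 2 else
            H m i (f (m, k) i) * H m j (f (m, k) j)) :=
          mul_le_mul_of_nonneg_left (Finset.sum_le_sum fun k _ =>
            sum_blockReverse_mul_mean_sq hp hp1 (f (m, k)) (κ m) (hT m)) (inv_nonneg.2 hK.le)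
      _ = ∑ i, ∑ j, (K : ℝ)⁻¹ * ∑ k, (if i = j then β ^ 2 else
            H m i (f (m, k) i) * H m j (f (m, k) j)) := by
          rw [Finset.sum_comm, Finset.mul_sum]
          refine Finset.sum_congr rfl fun i _ => ?_
          rw [Finset.sum_comm, Finset.mul_sum]
      _ ≤ ∑ i, ∑ j, ((if i = j then β ^ 2 else 0) + β ^ 2 * pairDeviation p f m i j) := by
          refine Finset.sum_le_sum fun i _ => Finset.sum_le_sum fun j _ => ?_
          split_ifs with hij
          · have := mul_nonneg (sq_nonneg β) (pairDeviation_nonneg p f m i j)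
            rw [Finset.sum_const, Finset.card_univ, Fintype.card_fin, nsmul_eq_mul,
              inv_mul_cancel_left₀ hK.ne']
            linarith
          · rw [zero_add]
            exact hpair m i j hij
      _ = _ := by
          simp only [Finset.sum_add_distrib, Finset.sum_ite_eq, Finset.mem_univ, if_true,
            ← Finset.mul_sum, Finset.sum_const, Finset.card_univ, Fintype.card_fin, nsmul_eq_mul]
          ring
  calc _ ≤ (M : ℝ)⁻¹ * ∑ m, β ^ 2 * (n + ∑ i, ∑ j, pairDeviation p f m i j) :=
        mul_le_mul_of_nonneg_left (Finset.sum_le_sum fun m _ => hm m) (inv_nonneg.2 hM.le)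
    _ = _ := by
        rw [averageDeviation, ← Finset.mul_sum, Finset.sum_add_distrib]
        simp only [Finset.sum_const, Finset.card_univ, Fintype.card_fin, nsmul_eq_mul]
        field_simp

theorem idealMean_mono {Y : Type*} [Fintype Y] {p : X → Y → ℝ} (hp : ∀ x y, 0 ≤ p x y)
    (f : Fin M × Fin K → Fin n → Y) {G G' : (Fin n → X) → (Fin n → Y) → Fin M → ℝ}
    (h : ∀ m k x, blockReverse p (f (m, k)) x ≠ 0 → G x (f (m, k)) m ≤ G' x (f (m, k)) m) :
    idealMean p f G ≤ idealMean p f G' := by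
  refine mul_le_mul_of_nonneg_left (Finset.sum_le_sum fun m _ => mul_le_mul_of_nonneg_left
    (Finset.sum_le_sum fun k _ => Finset.sum_le_sum fun x _ => ?_) ?_) ?_
  · by_cases h0 : blockReverse p (f (m, k)) x = 0
    · rw [h0, zero_mul, zero_mul]
    · exact mul_le_mul_of_nonneg_left (h m k x h0) (blockReverse_nonneg hp _ _)
  · positivity
  · positivity

theorem idealMean_mul_left {Y : Type*} [Fintype Y] (p : X → Y → ℝ)
    (f : Fin M × Fin K → Fin n → Y) (G : (Fin n → X) → (Fin n → Y) → Fin M → ℝ) (a : ℝ) :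
    (idealMean p f fun x y m => a * G x y m) = a * idealMean p f G := by
  simp only [idealMean, Finset.mul_sum]
  refine Finset.sum_congr rfl fun m _ => Finset.sum_congr rfl fun k _ =>
    Finset.sum_congr rfl fun x _ => by ring

end IdealLaw

/-! ### Achievability of the single-letter region -/

section Achievability

variable {X Y Z Wx Wy : Type*} [Fintype X] [Fintype Y] [DecidableEq Y] [Fintype Z] [Nonempty Z]
  {n : ℕ} {R R₀ : ℝ}

theorem sum_couplings {Y : Type*} [Fintype Y] {PX : PMF X} {p : X → Y → ℝ}
    (hp : p ∈ couplings fun x => (PX x).toReal) : ∑ x, ∑ y, p x y = 1 := by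
  simp only [hp.2, sum_toReal_eq_one]

/-- The two losses are the passage from the code to the idealized law and the residual dependence of
`Y_i` on the message, uniformly in `i` and the strategy. -/
theorem le_mean_symbolLaw_likelihoodCode {PX : PMF X} (PWx : X → PMF Wx) (PWy : Y → PMF Wy)
    {p : X → Y → ℝ} (hp : p ∈ couplings fun x => (PX x).toReal) (hM : 0 < indexSize n R)
    (hK : 0 < indexSize n R₀) (f : Fin (indexSize n R) × Fin (indexSize n R₀) → Fin n → Y)
    {r : X → Y → Z → ℝ} {B P : ℝ} (hB0 : 0 ≤ B) (hB : ∀ x y z, |r x y z| ≤ B)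
    (hP : ∀ z : Wx × Wy → Z, P ≤ ∑ x, ∑ y, p x y * ∑ w, pureKernel PWx PWy z x y w * r x y w)
    (i : Fin n) (s : Fin (indexSize n R) → Wx × Wy → PMF Z) :
    P - B * (coveringDeviation p f + averageDeviation p f) ≤
      mean (symbolLaw PX PWx PWy (likelihoodCode hp.1 hM hK f) i s)
        fun ω => r ω.1 ω.2.1 ω.2.2 := by
  have : NeZero (indexSize n R) := ⟨hM.ne'⟩
  rw [mean_symbolLaw]
  have h1 := abs_mean_codeLaw_sub_idealMean_le hp hM hK f
    (G := fun x y m => mean (effectiveChannel PWx PWy (s m) (x i) (y i)) (r (x i) (y i)))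
    (fun x y m => abs_mean_le _ fun z => hB _ _ z)
  have h2 := le_idealMean_coordinate hp.1 (sum_couplings hp) f i
    (h := fun m x y => mean (effectiveChannel PWx PWy (s m) x y) (r x y)) hB0
    (fun m x y => abs_mean_le _ fun z => hB _ _ z)
    (fun m => le_sum_mean_effectiveChannel PWx PWy hP (s m))
  linarith [(abs_le.1 h1).1]

/-- Failure has a bounded indicator, so its probability can be moved to the idealized law even when
payoffs are `-∞`. There `-∞` never occurs, and Chebyshev applies around the means `μ m i ≥ P`. -/
theorem le_assured_likelihoodCode {PX : PMF X} (PWx : X → PMF Wx) (PWy : Y → PMF Wy)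
    {p : X → Y → ℝ} (hp : p ∈ couplings fun x => (PX x).toReal) (hM : 0 < indexSize n R)
    (hK : 0 < indexSize n R₀) {f : Fin (indexSize n R) × Fin (indexSize n R₀) → Fin n → Y}
    (hf : ∀ l i, 0 < marginal p (f l i)) (hn : 0 < n)
    {π : X → Y → Z → EReal} (htop : ∀ x y z, π x y z ≠ ⊤)
    (hbot : ∀ x y, 0 < p x y → ∀ z, π x y z ≠ ⊥) {B P ε : ℝ} (hε : 0 < ε) (hB0 : 0 ≤ B)
    (hB : ∀ x y z, |(π x y z).toReal| ≤ B)
    (hP : ∀ z : Wx × Wy → Z,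
      P ≤ ∑ x, ∑ y, p x y * ∑ w, pureKernel PWx PWy z x y w * (π x y w).toReal)
    (s : Fin n → Fin (indexSize n R) → Wx × Wy → PMF Z) :
    1 - (coveringDeviation p f + (2 * B) ^ 2 * (n + averageDeviation p f) / (n * ε) ^ 2) ≤
      ((blockLaw PX PWx PWy (likelihoodCode hp.1 hM hK f) s).toOuterMeasure
        {ω | ((P - ε : ℝ) : EReal) ≤ blockPayoff π ω}).toReal := by
  classical
  have : NeZero (indexSize n R) := ⟨hM.ne'⟩
  have : NeZero (indexSize n R₀) := ⟨hK.ne'⟩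
  have hp1 := sum_couplings hp
  have hn' : (0 : ℝ) < n := by exact_mod_cast hn
  set c := likelihoodCode hp.1 hM hK f with hc
  set bad : (Fin n → X) × (Fin n → Y) × (Fin n → Z) → ℝ := fun ω =>
    if ((P - ε : ℝ) : EReal) ≤ blockPayoff π ω then 0 else 1 with hbad
  have hgood : (mean (blockLaw PX PWx PWy c s) fun ω =>
      if ω ∈ {ω | ((P - ε : ℝ) : EReal) ≤ blockPayoff π ω} then (1 : ℝ) else 0)
      = 1 - mean (blockLaw PX PWx PWy c s) bad := by
    have e : (fun ω => if ω ∈ {ω | ((P - ε : ℝ) : EReal) ≤ blockPayoff π ω} then (1 : ℝ) else 0)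
        = fun ω : (Fin n → X) × (Fin n → Y) × (Fin n → Z) => 1 + (-1) * bad ω := by
      funext ω
      simp only [hbad, Set.mem_ofPred_eq]
      split_ifs <;> norm_num
    rw [e, mean_add, mean_const, mean_mul_left]
    ring
  rw [toOuterMeasure_toReal, hgood, mean_blockLaw]
  set κ : Fin (indexSize n R) → Fin n → X → Y → PMF Z := fun m i x y =>
    effectiveChannel PWx PWy (s i m) x y with hκ
  set μ : Fin (indexSize n R) → Fin n → ℝ := fun m i =>
    ∑ x, ∑ y, p x y * mean (κ m i x y) fun z => (π x y z).toReal with hμ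
  have hPμ : ∀ m i, P ≤ μ m i := fun m i =>
    le_sum_mean_effectiveChannel PWx PWy (f := fun x y z => (π x y z).toReal) hP (s i m)
  have hμB : ∀ m i, |μ m i| ≤ B := by
    intro m i
    calc |μ m i| ≤ ∑ x, ∑ y, p x y * B := by
          refine (Finset.abs_sum_le_sum_abs _ _).trans (Finset.sum_le_sum fun x _ =>
            (Finset.abs_sum_le_sum_abs _ _).trans (Finset.sum_le_sum fun y _ => ?_))
          rw [abs_mul, abs_of_nonneg (hp.1 x y)]
          exact mul_le_mul_of_nonneg_left (abs_mean_le _ fun z => hB _ _ _) (hp.1 x y)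
      _ = B := by simp only [← Finset.sum_mul, hp1, one_mul]
  have h1 := abs_mean_codeLaw_sub_idealMean_le hp hM hK f (B := 1)
    (G := fun x y m => mean (productPMF fun i => κ m i (x i) (y i)) fun z => bad (x, y, z))
    (fun x y m => abs_mean_le _ fun z => by
      simp only [hbad]
      split_ifs <;> simp)
  have h2 : (idealMean p f fun x y m => mean (productPMF fun i => κ m i (x i) (y i))
      fun z => bad (x, y, z)) ≤ idealMean p f fun x y m => ((n * ε) ^ 2)⁻¹ *
        mean (productPMF fun i => κ m i (x i) (y i)) fun z =>
          (∑ i, ((π (x i) (y i) (z i)).toReal - μ m i)) ^ 2 := by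
    refine idealMean_mono hp.1 f fun m k x hx => ?_
    rw [← mean_mul_left]
    refine mean_mono _ fun z _ => ?_
    simp only [hbad]
    split_ifs with hz
    · positivity
    -- Codeword letters have positive marginal and `x` has positive likelihood, so every pair lies
    -- in the support of `p`, where payoffs are finite.
    have hpos : ∀ i, 0 < p (x i) (f (m, k) i) := fun i => by
      rw [← marginal_mul_reverse hp.1]
      exact mul_pos (hf _ _) ((reverse_nonneg hp.1 _ _).lt_of_ne
        (Finset.prod_ne_zero_iff.1 hx i (Finset.mem_univ i)).symm)
    have hlt : (n : ℝ)⁻¹ * ∑ i, (π (x i) (f (m, k) i) (z i)).toReal < P - ε := by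
      by_contra! hge
      exact hz ((coe_le_inv_mul_sum_iff hn (fun i => htop _ _ _) _).2
        ⟨fun i => hbot _ _ (hpos i) _, hge⟩)
    rw [inv_mul_lt_iff₀ hn'] at hlt
    have hμsum : n * P ≤ ∑ i, μ m i := by
      calc (n : ℝ) * P = ∑ _i : Fin n, P := by simp
        _ ≤ _ := Finset.sum_le_sum fun i _ => hPμ m i
    -- The payoff sum lies below `n (P - ε)` and the sum of means is at least `n P`, so the centered
    -- sum is below `-n ε`.
    rw [le_inv_mul_iff₀ (by positivity), mul_one, Finset.sum_sub_distrib]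
    have : 0 < n * ε := by positivity
    nlinarith
  have h3 := idealMean_sq_le hp.1 hp1 f κ (T := fun m i x y z => (π x y z).toReal - μ m i)
    (β := 2 * B) (by positivity)
    (fun m i x y z => (abs_sub _ _).trans (by linarith [hB x y z, hμB m i])) (fun m i => by
      simp only [sub_eq_add_neg, mean_add, mean_const, mul_add, Finset.sum_add_distrib,
        ← Finset.sum_mul, hp1]
      simp [hμ])
  rw [idealMean_mul_left] at h2
  have h4 := mul_le_mul_of_nonneg_left h3 (inv_nonneg.2 (sq_nonneg (n * ε)))
  rw [div_eq_inv_mul]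
  linarith [(abs_le.1 h1).2]

/-- The constant strategy `z` realizes the triple with the full mass `p x y`, which tolerance zero
forbids if the payoff is `-∞`. -/
theorem Feasible.ne_bot {X Y Z Wx Wy : Type*} [Fintype X] [Fintype Y] [Fintype Z]
    {p : X → Y → ℝ} {PWx : X → PMF Wx} {PWy : Y → PMF Wy}
    {π : X → Y → Z → EReal} {t : ℝ × ℝ × ℝ} (h : Feasible (pureKernel PWx PWy) π p (0, t))
    {x : X} {y : Y} (hxy : 0 < p x y) (z : Z) : π x y z ≠ ⊥ := by
  intro hb
  have := (h.2.2 fun _ => z).1 x y z hb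
  have e : pureKernel PWx PWy (fun _ => z) x y z = 1 := by
    simp [pureKernel, effectiveChannel, PMF.bind_const]
  rw [e, mul_one] at this
  exact absurd hxy (not_lt.2 this)

/-- The slack `ε` gives a rate strictly above the mutual information, a positive key rate and room
for Chebyshev. The same codebooks serve both criteria. -/
theorem achievable_of_feasible {PX : PMF X} {PWx : X → PMF Wx} {PWy : Y → PMF Wy}
    {π : X → Y → Z → EReal} (htop : ∀ x y z, π x y z ≠ ⊤) {t : ℝ × ℝ × ℝ}
    (ht : t ∈ singleLetterRegion PX PWx PWy π) {ε : ℝ} (hε : 0 < ε) :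
    AchievableWhp PX PWx PWy π (t.1 + ε) (t.2.1 + ε) (t.2.2 - ε) ∧
      ((∀ x y z, π x y z ≠ ⊥) →
        AchievableMin PX PWx PWy π (t.1 + ε) (t.2.1 + ε) (t.2.2 - ε)) := by
  obtain ⟨p, hp, hfeas⟩ := (mem_singleLetterRegion_iff PX PWx PWy htop t).1 ht
  have hp1 := sum_couplings hp
  have hR : info p < t.1 + ε := lt_add_of_le_of_pos hfeas.1 hε
  have hR₀ : 0 < t.2.1 + ε := add_pos_of_nonneg_of_pos hfeas.2.1 hε
  have hRpos : 0 < t.1 + ε := (info_nonneg hp.1 hp1).trans_lt hR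
  have hP : ∀ z, t.2.2 ≤ _ := fun z => (hfeas.2.2 z).2
  obtain ⟨B, hB0, hB⟩ := exists_abs_le fun x y z => (π x y z).toReal
  obtain ⟨f, hf, hcov, havg⟩ := exists_codebook_sequence hp.1 hp1 hR hR₀
  have hM := fun n => indexSize_pos_of_nonneg n hRpos.le
  have hK := fun n => indexSize_pos_of_nonneg n hR₀.le
  refine ⟨⟨fun n => likelihoodCode hp.1 (hM n) (hK n) (f n), ?_⟩, fun hbot =>
    ⟨fun n => likelihoodCode hp.1 (hM n) (hK n) (f n), ?_⟩⟩
  · have hlim : Tendsto (fun n : ℕ => 1 - (coveringDeviation p (f n)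
        + (2 * B) ^ 2 * (n + averageDeviation p (f n)) / (n * ε) ^ 2)) atTop (𝓝 1) := by
      have h1 : Tendsto (fun n : ℕ => (2 * B / ε) ^ 2 * ((n : ℝ)⁻¹
          + averageDeviation p (f n) * ((n : ℝ)⁻¹ * (n : ℝ)⁻¹))) atTop (𝓝 0) := by
        have hinv := tendsto_inv_atTop_nhds_zero_nat (𝕜 := ℝ)
        simpa using (hinv.add (havg.mul (hinv.mul hinv))).const_mul ((2 * B / ε) ^ 2)
      have h2 := (tendsto_const_nhds (x := (1 : ℝ))).sub (hcov.add h1)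
      rw [add_zero, sub_zero] at h2
      refine h2.congr' ?_
      filter_upwards [eventually_gt_atTop 0] with n hn
      have hn' : (n : ℝ) ≠ 0 := by exact_mod_cast hn.ne'
      field_simp
    have hlim' := ENNReal.tendsto_ofReal hlim
    rw [ENNReal.ofReal_one] at hlim'
    refine tendsto_of_tendsto_of_tendsto_of_le_of_le' hlim' tendsto_const_nhds ?_
      (Eventually.of_forall fun n => ?_)
    · filter_upwards [eventually_gt_atTop 0] with n hn
      refine le_iInf fun s => ENNReal.ofReal_le_of_le_toReal ?_
      exact le_assured_likelihoodCode PWx PWy hp (hM n) (hK n) (hf n) hn htop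
        (fun x y hxy z => hfeas.ne_bot hxy z) hε hB0 hB hP s
    -- The upper bound needs some strategy to exist, which is where a nonempty action set enters.
    · exact (iInf_le _ fun _ _ _ => PMF.pure (Classical.arbitrary Z)).trans
        (toOuterMeasure_le_one _ _)
  · have hlim : Tendsto (fun n : ℕ => t.2.2 - B * (coveringDeviation p (f n)
        + averageDeviation p (f n))) atTop (𝓝 t.2.2) := by
      simpa using tendsto_const_nhds.sub ((hcov.add havg).const_mul B)
    refine le_liminf_of_le (by isBoundedDefault) ?_
    filter_upwards [hlim.eventually (eventually_ge_nhds (sub_lt_self t.2.2 hε))] with n hn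
    refine le_iInf fun i => le_iInf fun s =>
      (coe_le_expect_iff _ (fun ω => htop _ _ _) _).2 ⟨fun ω hω => absurd hω (hbot _ _ _), ?_⟩
    exact hn.trans (le_mean_symbolLaw_likelihoodCode PWx PWy hp (hM n) (hK n) (f n) hB0 hB hP i s)

theorem mem_ratePayoffRegion_of_forall_pos {achievable : ℝ → ℝ → ℝ → Prop} {t : ℝ × ℝ × ℝ}
    (h : ∀ ε > 0, achievable (t.1 + ε) (t.2.1 + ε) (t.2.2 - ε)) :
    t ∈ ratePayoffRegion achievable := by
  have h0 := tendsto_one_div_add_atTop_nhds_zero_nat (𝕜 := ℝ)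
  have hlim : Tendsto (fun k : ℕ => (t.1 + 1 / ((k : ℝ) + 1), t.2.1 + 1 / ((k : ℝ) + 1),
      t.2.2 - 1 / ((k : ℝ) + 1))) atTop (𝓝 (t.1 + 0, t.2.1 + 0, t.2.2 - 0)) :=
    (h0.const_add _).prodMk_nhds ((h0.const_add _).prodMk_nhds (h0.const_sub _))
  simp only [add_zero, sub_zero] at hlim
  exact mem_closure_of_tendsto hlim (Eventually.of_forall fun k => h _ (by positivity))

end Achievability

end SecrecyCoding

end

theorem mainTheorem8 {X Y Z Wx Wy : Type*} [Fintype X] [Fintype Y] [Fintype Z] [Nonempty Z]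
    (PX : PMF X) (PWx : X → PMF Wx) (PWy : Y → PMF Wy)
    (π : X → Y → Z → EReal) (hπ : ∀ x y z, π x y z ≠ ⊤) :
    SecrecyCoding.ratePayoffRegion (SecrecyCoding.AchievableWhp PX PWx PWy π) =
        SecrecyCoding.singleLetterRegion PX PWx PWy π ∧
      ((∀ x y z, π x y z ≠ ⊥) →
        SecrecyCoding.ratePayoffRegion (SecrecyCoding.AchievableAvg PX PWx PWy π) =
            SecrecyCoding.singleLetterRegion PX PWx PWy π ∧
          SecrecyCoding.ratePayoffRegion (SecrecyCoding.AchievableMin PX PWx PWy π) =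
            SecrecyCoding.singleLetterRegion PX PWx PWy π) := by
  classical
  have hclosed := SecrecyCoding.isClosed_singleLetterRegion PX PWx PWy hπ
  refine ⟨Set.Subset.antisymm (closure_minimal (fun t ht => ht.mem_singleLetterRegion hπ) hclosed)
    fun t ht => SecrecyCoding.mem_ratePayoffRegion_of_forall_pos fun ε hε =>
      (SecrecyCoding.achievable_of_feasible hπ ht hε).1, fun hbot => ?_⟩
  have hAvg : SecrecyCoding.ratePayoffRegion (SecrecyCoding.AchievableAvg PX PWx PWy π) ⊆
      SecrecyCoding.singleLetterRegion PX PWx PWy π :=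
    closure_minimal (fun t ht => ht.mem_singleLetterRegion hπ hbot) hclosed
  have hMin : SecrecyCoding.singleLetterRegion PX PWx PWy π ⊆
      SecrecyCoding.ratePayoffRegion (SecrecyCoding.AchievableMin PX PWx PWy π) :=
    fun t ht => SecrecyCoding.mem_ratePayoffRegion_of_forall_pos fun ε hε =>
      (SecrecyCoding.achievable_of_feasible hπ ht hε).2 hbot
  have hMinAvg : SecrecyCoding.ratePayoffRegion (SecrecyCoding.AchievableMin PX PWx PWy π) ⊆
      SecrecyCoding.ratePayoffRegion (SecrecyCoding.AchievableAvg PX PWx PWy π) :=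
    closure_mono fun t ht => SecrecyCoding.AchievableMin.achievableAvg hπ hbot ht
  -- The inclusions run from the single-letter region through the symbol-wise and the average region
  -- and back.
  exact ⟨hAvg.antisymm (hMin.trans hMinAvg), (hMinAvg.trans hAvg).antisymm hMin⟩
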